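/- Let $d,\mu,h_0>0$ and let $J:\mathbb R\to\mathbb R$ be continuous, bounded, nonnegative and even, with $J(0)>0$ and $\int_{\mathbb R}J(x)\,dx=1$. Let $f\in C^1(\mathbb R)$ satisfy $f(0)=0<f'(0)$, $f(u^*)=0>f'(u^*)$ for some $u^*>0$, and let $v\mapsto f(v)/v$ be strictly decreasing on $(0,\infty)$. Let $u_0\in C([0,h_0])$ with $u_0(h_0)=0<u_0(x)$ for $x\in[0,h_0)$. Let $(u,h)$ be a (global, classical) solution of $$\begin{cases} u_t(t,x)=d\displaystyle\int_0^{h(t)}J(x-y)u(t,y)\,dy-d\Big(\int_0^\infty J(x-y)\,dy\Big)u(t,x)+f(u(t,x)), & t>0,\ 0\le x<h(t),\\ u(t,h(t))=0, & t>0,\\ h'(t)=\mu\displaystyle\int_0^{h(t)}\!\int_{h(t)}^\infty J(x-y)u(t,x)\,dy\,dx, & t>0,\\ h(0)=h_0,\quad u(0,x)=u_0(x), & x\in[0,h_0], \end{cases}$$ that is, $h$ is continuous on $[0,\infty)$, $u$ is continuous on $\{(t,x):t\ge 0,\ 0\le x\le h(t)\}$, the derivatives $u_t$ and $h'$ exist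 where they appear, and the equations hold pointwise. **Theorem 4.1.** Let $\gamma\in(1,2]$, and suppose that there are $\varsigma_1,\varsigma_2>0$ with $\varsigma_1|x|^{-\gamma}\le J(x)\le\varsigma_2|x|^{-\gamma}$ for all sufficiently large $|x|$. Suppose that spreading happens, i.e. $\lim_{t\to\infty}h(t)=\infty$ and $u(t,\cdot)\to u^*$ as $t\to\infty$ locally uniformly in $[0,\infty)$. * If $\gamma\in(1,2)$, then there are $C_1,C_2>0$ such that $C_1t^{1/(\gamma-1)}\le h(t)\le C_2t^{1/(\gamma-1)}$ for all sufficiently large $t$; and for every function $s\ge 0$ with $s(t)=o(t^{1/(\gamma-1)})$ as $t\to\infty$, we have $s(t)\le h(t)$ for all sufficiently large $t$ and $$\lim_{t\to\infty}\max_{x\in[0,s(t)]}|u(t,x)-u^*|=0.$$ * If $\gamma=2$, then there are $C_1,C_2>0$ such that $C_1\,t\ln t\le h(t)\le C_2\,t\ln t$ for all sufficiently large $t$; and for every function $s\ge 0$ with $s(t)=o(t\ln t)$ as $t\to\infty$, we have $s(t)\le h(t)$ for all sufficiently large $t$ and $$\lim_{t\to\infty}\max_{x\in[0,s(t)]}|u(t,x)-u^*|=0.$$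 -/

import Mathlib

open Set Filter Topology MeasureTheory

namespace NonlocalFB

/-- Standing condition on the dispersal kernel: continuous, bounded, nonnegative, positive at the
origin, even, and of total mass one. -/
structure KernelCond (J : ℝ → ℝ) : Prop where
  continuous : Continuous J
  bounded : ∃ M : ℝ, ∀ x, J x ≤ M
  nonneg : ∀ x, 0 ≤ J x
  pos_zero : 0 < J 0
  even : ∀ x, J (-x) = J x
  integrable : Integrable J
  integral_eq_one : ∫ x, J x = 1

/-- The decay condition `J(x) ≈ |x|^{-γ}` near infinity. -/
def PowerTail (γ : ℝ) (J : ℝ → ℝ) : Prop :=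
  ∃ c₁ c₂ R : ℝ, 0 < c₁ ∧ 0 < c₂ ∧ 0 < R ∧
    ∀ x : ℝ, R ≤ |x| → c₁ * |x| ^ (-γ) ≤ J x ∧ J x ≤ c₂ * |x| ^ (-γ)

/-- Monostable condition on the growth term, with positive zero `ustar`. -/
structure GrowthCond (f : ℝ → ℝ) (ustar : ℝ) : Prop where
  contDiff : ContDiff ℝ 1 f
  zero : f 0 = 0
  deriv_zero_pos : 0 < deriv f 0
  ustar_pos : 0 < ustar
  ustar_zero : f ustar = 0
  deriv_ustar_neg : deriv f ustar < 0
  strictAnti : StrictAntiOn (fun v => f v / v) (Ioi 0)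

/-- Admissible initial data on `[0, h₀]`. -/
structure InitialCond (h₀ : ℝ) (u₀ : ℝ → ℝ) : Prop where
  h₀_pos : 0 < h₀
  continuousOn : ContinuousOn u₀ (Icc 0 h₀)
  right_zero : u₀ h₀ = 0
  pos : ∀ x ∈ Ico 0 h₀, 0 < u₀ x

/-- `(u, h)` is a global classical solution of the nonlocal free boundary problem with fixed left
boundary `0` and free right boundary `h t`. Only the values of `u t x` with
`0 ≤ t` and `0 ≤ x ≤ h t` matter. -/
structure IsSolution (d μ : ℝ) (J f : ℝ → ℝ) (h₀ : ℝ) (u₀ : ℝ → ℝ)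
    (u : ℝ → ℝ → ℝ) (h : ℝ → ℝ) : Prop where
  h_continuousOn : ContinuousOn h (Ici 0)
  u_continuousOn :
    ContinuousOn (fun p : ℝ × ℝ => u p.1 p.2) {p | 0 ≤ p.1 ∧ 0 ≤ p.2 ∧ p.2 ≤ h p.1}
  evolution : ∀ t x : ℝ, 0 < t → 0 ≤ x → x < h t →
    HasDerivAt (fun s => u s x)
      (d * (∫ y in (0 : ℝ)..(h t), J (x - y) * u t y)
        - d * (∫ y in Ioi (0 : ℝ), J (x - y)) * u t x + f (u t x)) t
  boundary : ∀ t : ℝ, 0 < t → u t (h t) = 0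
  free_boundary : ∀ t : ℝ, 0 < t →
    HasDerivAt h
      (μ * ∫ x in (0 : ℝ)..(h t), ∫ y in Ioi (h t), J (x - y) * u t x) t
  initial_h : h 0 = h₀
  initial_u : ∀ x ∈ Icc 0 h₀, u 0 x = u₀ x

/-- Spreading: `h(t) → ∞` and `u(t, ·) → ustar` locally uniformly in `[0, ∞)`. (Since
`h(t) → ∞`, every bounded subset of `[0, ∞)` is in the domain `[0, h(t)]` for large `t`.) -/
def Spreading (ustar : ℝ) (u : ℝ → ℝ → ℝ) (h : ℝ → ℝ) : Prop :=
  Tendsto h atTop atTop ∧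
    TendstoLocallyUniformlyOn u (fun _ => ustar) atTop (Ici 0)

/-- `a(t) ≈ b(t)` for large `t`: two-sided bound by positive constant multiples. -/
def Comparable (a b : ℝ → ℝ) : Prop :=
  ∃ C₁ C₂ : ℝ, 0 < C₁ ∧ 0 < C₂ ∧ ∀ᶠ t in atTop, C₁ * b t ≤ a t ∧ a t ≤ C₂ * b t

/-- `max_{x ∈ [0, s(t)]} |u(t, x) - ustar| → 0` as `t → ∞`, where the interval `[0, s(t)]`
eventually lies in the domain `[0, h(t)]` of `u(t, ·)`. -/
def ConvergesUpTo (ustar : ℝ) (u : ℝ → ℝ → ℝ) (h s : ℝ → ℝ) : Prop :=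
  (∀ᶠ t in atTop, s t ≤ h t) ∧
    ∀ ε : ℝ, 0 < ε → ∀ᶠ t in atTop, ∀ x ∈ Icc 0 (s t), |u t x - ustar| < ε

end NonlocalFB

namespace NonlocalFB

/-! The front obeys `h' = μ ∫₀^h tail J (h - x) u dx`, and the power tail makes `∫₀^g tail J` of
order `G(g) = g^(2-γ)` for `γ < 2` and `G(g) = log g` for `γ = 2`. Both bounds say that `h'` is
comparable to `G(h)`, and the ODE `g' = c G(g)` has the growth `t^(1/(γ-1))`, respectively `t log
t`.

Upper bound: comparison with constants gives `u ≤ M`, hence `h' ≤ C G(h)`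
(`IsSolution.exists_speed_le`), which is integrated. A barrier decreasing linearly in time gives `u
≤ ustar + ε` for all large times, uniformly in space (`IsSolution.eventually_le`).

Lower bound: for each `A < ustar` a ramp, equal to `A` up to `g - w` and falling linearly to `0` at
`g`, with `w = g^σ / 2`, is a strict lower solution as long as `g' < c G(g)` (`exists_ramp_width`,
`IsSolution.ramp_le`). Its time derivative is at most `(A/w) g'`. On the upper half of the ramp and
on the plateau the reaction pays for this; lower down, but further than `b` from the front, the
reaction still yields order `(A/w) b`; within `b` of the front the convex kink at the foot yields
order `(A/w) ∫ z J(z) dz` over `[2b, w/2]`. With `σ = 1` for `γ < 2` and `σ = 1/2` for `γ = 2`, a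
suitable `b` makes these gains and the flux of the ramp at least of order `G(g)`. Spreading places
`u` above the ramp at some starting time.

Since the plateau covers `[0, g/2]`, `u ≥ A` holds there. Letting `A` approach `ustar` and using the
uniform upper bound gives convergence on `[0, s(t)]` (`IsSolution.comparable_and_converges`). -/

/-! ### Minimum principle on a moving domain -/

/-- Only earlier times are compared, so this applies at the final time of a strip and at the first
contact of two fronts. -/
theorem hasDerivAt_nonpos_of_left {φ : ℝ → ℝ} {D t : ℝ} (hφ : HasDerivAt φ D t)
    (hle : ∀ᶠ s in 𝓝[<] t, φ t ≤ φ s) : D ≤ 0 := by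
  have h1 : Tendsto (slope φ t) (𝓝[<] t) (𝓝 D) := by
    have := (hφ.hasDerivWithinAt (s := Iio t))
    rwa [hasDerivWithinAt_iff_tendsto_slope' (by simp)] at this
  refine le_of_tendsto h1 ?_
  filter_upwards [hle, self_mem_nhdsWithin] with s hs hst
  rw [slope_def_field]
  exact div_nonpos_of_nonneg_of_nonpos (by linarith) (by have : s < t := hst; linarith)

theorem isCompact_moving_domain {g : ℝ → ℝ} {t₀ t₁ : ℝ} (hg : ContinuousOn g (Icc t₀ t₁)) :
    IsCompact {p : ℝ × ℝ | (t₀ ≤ p.1 ∧ p.1 ≤ t₁) ∧ 0 ≤ p.2 ∧ p.2 ≤ g p.1} := by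
  obtain ⟨B, hB⟩ := (isCompact_Icc.image_of_continuousOn hg).bddAbove
  have hc : IsCompact (Icc t₀ t₁ ×ˢ Icc (0 : ℝ) B) := isCompact_Icc.prod isCompact_Icc
  have hcont : ContinuousOn (fun p : ℝ × ℝ => g p.1 - p.2) (Icc t₀ t₁ ×ˢ Icc (0 : ℝ) B) :=
    (hg.comp continuousOn_fst (fun p hp => hp.1)).sub continuousOn_snd
  have hcl := hcont.preimage_isClosed_of_isClosed hc.isClosed (isClosed_Ici (a := (0 : ℝ)))
  refine (hc.of_isClosed_subset hcl inter_subset_left).of_isClosed_subset ?_ ?_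
  · convert hcl using 1
    ext p
    constructor
    · rintro ⟨h1, h2, h3⟩
      exact ⟨⟨h1, h2, h3.trans (hB (mem_image_of_mem g h1))⟩, sub_nonneg.2 h3⟩
    · rintro ⟨⟨h1, h2⟩, h3⟩
      exact ⟨h1, h2.1, sub_nonneg.1 h3⟩
  · rintro p ⟨h1, h2, h3⟩
    exact ⟨⟨h1, h2, h3.trans (hB (mem_image_of_mem g h1))⟩, sub_nonneg.2 h3⟩

/-- A minimum principle on the moving domain `0 ≤ x ≤ g t`: only the points where `W t` has a
negative spatial minimum have to be examined, and there a function touching `W` from above on the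
left suffices. -/
theorem minimum_principle {W : ℝ → ℝ → ℝ} {g : ℝ → ℝ} {t₀ t₁ L : ℝ}
    (hg : ContinuousOn g (Icc t₀ t₁))
    (hW : ContinuousOn (fun p : ℝ × ℝ => W p.1 p.2)
      {p | (t₀ ≤ p.1 ∧ p.1 ≤ t₁) ∧ 0 ≤ p.2 ∧ p.2 ≤ g p.1})
    (h0 : ∀ x, 0 ≤ x → x ≤ g t₀ → 0 ≤ W t₀ x)
    (hb : ∀ t, t₀ < t → t ≤ t₁ → 0 ≤ W t (g t))
    (hstep : ∀ t, t₀ < t → t ≤ t₁ → ∀ x, 0 ≤ x → x < g t → W t x < 0 →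
      (∀ y, 0 ≤ y → y ≤ g t → W t x ≤ W t y) →
      ∃ (φ : ℝ → ℝ) (D : ℝ), HasDerivAt φ D t ∧ φ t = W t x ∧
        (∀ᶠ s in 𝓝[<] t, W s x ≤ φ s) ∧ L * W t x ≤ D) :
    ∀ t, t₀ ≤ t → t ≤ t₁ → ∀ x, 0 ≤ x → x ≤ g t → 0 ≤ W t x := by
  intro t ht ht' x hx hx'
  by_contra! hneg
  set D : Set (ℝ × ℝ) := {p | (t₀ ≤ p.1 ∧ p.1 ≤ t₁) ∧ 0 ≤ p.2 ∧ p.2 ≤ g p.1} with hD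
  have hK : IsCompact D := isCompact_moving_domain hg
  have hmem : (t, x) ∈ D := ⟨⟨ht, ht'⟩, hx, hx'⟩
  -- The weight beats the zeroth-order term: at a negative minimum of `exp(-(L+1)t) W` the left
  -- derivative must be nonpositive, whereas `L W ≤ D` and `W < 0` give `D - (L+1) W ≥ -W > 0`.
  have hcont : ContinuousOn (fun p : ℝ × ℝ => Real.exp (-(L + 1) * p.1) * W p.1 p.2) D :=
    ContinuousOn.mul (by fun_prop) hW
  obtain ⟨⟨s, z⟩, hsz, hmin⟩ := hK.exists_isMinOn ⟨_, hmem⟩ hcont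
  have hmin' : ∀ p ∈ D, Real.exp (-(L + 1) * s) * W s z ≤
      Real.exp (-(L + 1) * p.1) * W p.1 p.2 := fun p hp => hmin hp
  obtain ⟨⟨hs0, hs1⟩, hz0, hz1⟩ := hsz
  simp only at hs0 hs1 hz0 hz1
  have hneg' : W s z < 0 := by
    have h1 := hmin' _ hmem
    have h2 : Real.exp (-(L + 1) * t) * W t x < 0 :=
      mul_neg_of_pos_of_neg (Real.exp_pos _) hneg
    by_contra! h3
    have := mul_nonneg (Real.exp_pos (-(L + 1) * s)).le h3
    simp only at h1
    linarith
  have hst : t₀ < s := by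
    rcases hs0.lt_or_eq with h | h
    · exact h
    · subst h
      exact absurd (h0 z hz0 hz1) (not_le.2 hneg')
  have hzg : z < g s := by
    rcases hz1.lt_or_eq with h | h
    · exact h
    · rw [h] at hneg'
      exact absurd (hb s hst hs1) (not_le.2 hneg')
  obtain ⟨φ, E, hφ, hφs, hφle, hE⟩ := hstep s hst hs1 z hz0 hzg hneg' (by
    intro y hy hy'
    have := hmin' (s, y) ⟨⟨hs0, hs1⟩, hy, hy'⟩
    exact le_of_mul_le_mul_left this (Real.exp_pos _))
  have hd : HasDerivAt (fun r => Real.exp (-(L + 1) * r) * φ r)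
      (Real.exp (-(L + 1) * s) * (-(L + 1)) * φ s + Real.exp (-(L + 1) * s) * E) s := by
    have h1 : HasDerivAt (fun r : ℝ => -(L + 1) * r) (-(L + 1)) s := by
      simpa using (hasDerivAt_id s).const_mul (-(L + 1))
    exact h1.exp.mul hφ
  have hle : ∀ᶠ r in 𝓝[<] s, Real.exp (-(L + 1) * s) * φ s ≤ Real.exp (-(L + 1) * r) * φ r := by
    have hgs : ∀ᶠ r in 𝓝[Icc t₀ t₁] s, z < g r :=
      (hg s ⟨hs0, hs1⟩).eventually (lt_mem_nhds hzg)
    have hsub : 𝓝[Ioo t₀ s] s ≤ 𝓝[Icc t₀ t₁] s :=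
      nhdsWithin_mono _ fun r hr => ⟨hr.1.le, hr.2.le.trans hs1⟩
    rw [← nhdsWithin_Ioo_eq_nhdsLT hst] at hφle ⊢
    filter_upwards [hφle, hsub hgs, self_mem_nhdsWithin] with r hr1 hr2 hr3
    have := hmin' (r, z) ⟨⟨hr3.1.le, hr3.2.le.trans hs1⟩, hz0, le_of_lt hr2⟩
    rw [hφs]
    exact this.trans (mul_le_mul_of_nonneg_left hr1 (Real.exp_pos _).le)
  have hfin := hasDerivAt_nonpos_of_left hd hle
  have hfac : Real.exp (-(L + 1) * s) * (-(L + 1)) * φ s + Real.exp (-(L + 1) * s) * E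
      = Real.exp (-(L + 1) * s) * (E - (L + 1) * φ s) := by ring
  rw [hfac, hφs] at hfin
  have h3 : 0 < E - (L + 1) * W s z := by linarith
  have := mul_pos (Real.exp_pos (-(L + 1) * s)) h3
  linarith

/-! ### Kernel: tail mass and truncated convolution -/

/-- The tail mass `∫_r^∞ J`. -/
noncomputable def tail (J : ℝ → ℝ) (r : ℝ) : ℝ := ∫ y in Ioi r, J y

namespace KernelCond

variable {J : ℝ → ℝ}

theorem comp_sub (hJ : KernelCond J) (x y : ℝ) : J (x - y) = J (y - x) := by
  rw [← hJ.even, neg_sub]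

theorem integrable_sub (hJ : KernelCond J) (x : ℝ) : Integrable fun y => J (x - y) := by
  simp only [hJ.comp_sub x]
  exact hJ.integrable.comp_sub_right x

theorem setIntegral_Ioi_sub (hJ : KernelCond J) (x a : ℝ) :
    ∫ y in Ioi a, J (x - y) = tail J (a - x) := by
  rw [tail, ← integral_indicator measurableSet_Ioi, ← integral_indicator measurableSet_Ioi,
    ← integral_sub_right_eq_self ((Ioi (a - x)).indicator J) x]
  congr 1
  ext y
  simp only [indicator, mem_Ioi, sub_lt_sub_iff_right, hJ.comp_sub x y]

theorem tail_nonneg (hJ : KernelCond J) (r : ℝ) : 0 ≤ tail J r :=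
  setIntegral_nonneg measurableSet_Ioi fun _ _ => hJ.nonneg _

theorem tail_antitone (hJ : KernelCond J) : Antitone (tail J) := fun _ _ hrs =>
  setIntegral_mono_set hJ.integrable.integrableOn (ae_of_all _ hJ.nonneg)
    (LE.le.eventuallyLE (Ioi_subset_Ioi hrs))

theorem tail_le_one (hJ : KernelCond J) (r : ℝ) : tail J r ≤ 1 := by
  rw [← hJ.integral_eq_one]
  exact setIntegral_le_integral hJ.integrable (ae_of_all _ hJ.nonneg)

theorem tail_sub_tail (hJ : KernelCond J) (a b : ℝ) :
    tail J a - tail J b = ∫ y in a..b, J y :=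
  intervalIntegral.integral_Ioi_sub_Ioi' hJ.integrable.integrableOn hJ.integrable.integrableOn

theorem continuous_tail (hJ : KernelCond J) : Continuous (tail J) := by
  have : tail J = fun r => tail J 0 - ∫ y in (0 : ℝ)..r, J y := by
    ext r
    rw [← hJ.tail_sub_tail]; ring
  rw [this]
  exact continuous_const.sub (intervalIntegral.continuous_primitive
    (fun a b => hJ.integrable.intervalIntegrable) 0)

theorem tendsto_tail (hJ : KernelCond J) : Tendsto (tail J) atTop (𝓝 0) := by
  have h1 : Tendsto (fun r => ∫ y in (0 : ℝ)..r, J y) atTop (𝓝 (tail J 0)) :=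
    intervalIntegral_tendsto_integral_Ioi 0 hJ.integrable.integrableOn tendsto_id
  have h2 := (tendsto_const_nhds (x := tail J 0)).sub h1
  rw [sub_self] at h2
  refine h2.congr fun r => ?_
  rw [← hJ.tail_sub_tail]; ring

theorem intervalIntegral_sub_le (hJ : KernelCond J) (x : ℝ) {g : ℝ} (hg : 0 ≤ g) :
    ∫ y in (0 : ℝ)..g, J (x - y) ≤ ∫ y in Ioi (0 : ℝ), J (x - y) := by
  rw [intervalIntegral.integral_of_le hg]
  exact setIntegral_mono_set (hJ.integrable_sub x).integrableOn
    (ae_of_all _ fun _ => hJ.nonneg _) (LE.le.eventuallyLE Ioc_subset_Ioi_self)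

/-- Monotonicity of the truncated convolution in the density. -/
theorem conv_mono (hJ : KernelCond J) (x : ℝ) {g : ℝ} (hg : 0 ≤ g) {v w : ℝ → ℝ}
    (hv : ContinuousOn v (Icc 0 g)) (hw : ContinuousOn w (Icc 0 g))
    (hvw : ∀ y ∈ Icc 0 g, v y ≤ w y) :
    ∫ y in (0 : ℝ)..g, J (x - y) * v y ≤ ∫ y in (0 : ℝ)..g, J (x - y) * w y := by
  have hc : ContinuousOn (fun y => J (x - y)) (Icc 0 g) :=
    (hJ.continuous.comp (by fun_prop)).continuousOn
  refine intervalIntegral.integral_mono_on hg ?_ ?_ fun y hy =>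
    mul_le_mul_of_nonneg_left (hvw y hy) (hJ.nonneg _)
  · exact (hc.mul hv).intervalIntegrable_of_Icc hg
  · exact (hc.mul hw).intervalIntegrable_of_Icc hg

end KernelCond

/-! ### Consequences of the monostable condition -/

namespace GrowthCond

variable {f : ℝ → ℝ} {ustar : ℝ}

theorem exists_lipschitz (hf : GrowthCond f ustar) (a b : ℝ) :
    ∃ L : ℝ, 0 ≤ L ∧ ∀ v ∈ Icc a b, ∀ w ∈ Icc a b, |f w - f v| ≤ L * |w - v| := by
  have hc : Continuous (deriv f) := hf.contDiff.continuous_deriv le_rfl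
  obtain ⟨L, hL⟩ := isCompact_Icc.exists_bound_of_continuousOn (s := Icc a b) hc.continuousOn
  refine ⟨max L 0, le_max_right _ _, fun v hv w hw => ?_⟩
  exact (convex_Icc a b).norm_image_sub_le_of_norm_deriv_le
    (fun x _ => (hf.contDiff.differentiable one_ne_zero) x)
    (fun x hx => (hL x hx).trans (le_max_left _ _)) hv hw

theorem mul_lt (hf : GrowthCond f ustar) {v w : ℝ} (hv : 0 < v) (hvw : v < w) :
    f w * v < f v * w := by
  have := hf.strictAnti (mem_Ioi.2 hv) (mem_Ioi.2 (hv.trans hvw)) hvw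
  simp only at this
  rwa [div_lt_div_iff₀ (hv.trans hvw) hv] at this

theorem neg_of_lt (hf : GrowthCond f ustar) {v : ℝ} (hv : ustar < v) : f v < 0 := by
  have h1 := hf.mul_lt hf.ustar_pos hv
  rw [hf.ustar_zero, zero_mul] at h1
  by_contra! h2
  exact absurd (mul_nonneg h2 hf.ustar_pos.le) (not_le.2 h1)

theorem pos_of_lt (hf : GrowthCond f ustar) {v : ℝ} (hv0 : 0 < v) (hv : v < ustar) :
    0 < f v := by
  have h1 := hf.mul_lt hv0 hv
  rw [hf.ustar_zero, zero_mul] at h1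
  exact pos_of_mul_pos_left h1 hf.ustar_pos.le

/-- On `[0, A]` the growth term lies above its chord. -/
theorem chord_le (hf : GrowthCond f ustar) {A v : ℝ} (hA : 0 < A) (hv0 : 0 ≤ v) (hv : v ≤ A) :
    f A / A * v ≤ f v := by
  rcases hv0.eq_or_lt with h | h
  · subst h; simp [hf.zero]
  rcases hv.eq_or_lt with h' | h'
  · subst h'; rw [div_mul_cancel₀ _ hA.ne']
  · rw [div_mul_eq_mul_div, div_le_iff₀ hA]
    exact (hf.mul_lt h h').le

theorem le_of_le (hf : GrowthCond f ustar) {v w : ℝ} (hv : ustar < v) (hvw : v ≤ w) :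
    f w ≤ f v := by
  rcases hvw.eq_or_lt with h | h
  · rw [h]
  have hv0 : 0 < v := hf.ustar_pos.trans hv
  have h1 := hf.mul_lt hv0 h
  have h2 := hf.neg_of_lt hv
  nlinarith

end GrowthCond

/-! ### A priori bounds and comparison for the free boundary problem -/

section

variable {d μ h₀ ustar : ℝ} {J f u₀ : ℝ → ℝ} {u : ℝ → ℝ → ℝ} {h : ℝ → ℝ}

namespace IsSolution

theorem continuousOn_slice (hsol : IsSolution d μ J f h₀ u₀ u h) {t : ℝ} (ht : 0 ≤ t) :
    ContinuousOn (u t) (Icc 0 (h t)) :=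
  hsol.u_continuousOn.comp (f := fun x : ℝ => (t, x)) (by fun_prop)
    fun _ hx => ⟨ht, hx.1, hx.2⟩

theorem continuousOn_strip (hsol : IsSolution d μ J f h₀ u₀ u h) {g : ℝ → ℝ} {t₀ t₁ : ℝ}
    (ht₀ : 0 ≤ t₀) (hgh : ∀ t, t₀ ≤ t → t ≤ t₁ → g t ≤ h t) :
    ContinuousOn (fun p : ℝ × ℝ => u p.1 p.2)
      {p | (t₀ ≤ p.1 ∧ p.1 ≤ t₁) ∧ 0 ≤ p.2 ∧ p.2 ≤ g p.1} :=
  hsol.u_continuousOn.mono fun _ hp =>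
    ⟨ht₀.trans hp.1.1, hp.2.1, hp.2.2.trans (hgh _ hp.1.1 hp.1.2)⟩

/-- At a negative spatial minimum the dispersal terms add up to something nonnegative, because `∫₀^h
J ≤ ∫₀^∞ J` is multiplied by a negative value; `f 0 = 0` and a Lipschitz bound on `[-M, 0]` control
the reaction. -/
theorem nonneg (hd : 0 < d) (hJ : KernelCond J) (hf : GrowthCond f ustar)
    (hu₀ : InitialCond h₀ u₀) (hsol : IsSolution d μ J f h₀ u₀ u h)
    {t x : ℝ} (ht : 0 ≤ t) (hx : 0 ≤ x) (hxh : x ≤ h t) : 0 ≤ u t x := by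
  have hh : ContinuousOn h (Icc 0 t) := hsol.h_continuousOn.mono fun s hs => hs.1
  have hcont := hsol.continuousOn_strip (g := h) (t₁ := t) le_rfl fun _ _ _ => le_rfl
  obtain ⟨M, hM⟩ := (isCompact_moving_domain hh).exists_bound_of_continuousOn hcont
  obtain ⟨L, hL0, hL⟩ := hf.exists_lipschitz (-M) 0
  refine minimum_principle (L := L) hh hcont ?_ ?_ ?_ t ht le_rfl x hx hxh
  · intro y hy hy'
    rw [hsol.initial_h] at hy'
    rw [hsol.initial_u y ⟨hy, hy'⟩]
    rcases hy'.eq_or_lt with h1 | h1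
    · rw [h1, hu₀.right_zero]
    · exact (hu₀.pos y ⟨hy, h1⟩).le
  · intro s hs _
    rw [hsol.boundary s hs]
  · intro s hs hst z hz hzh hneg hmin
    refine ⟨fun r => u r z, _, hsol.evolution s z hs hz hzh, rfl,
      Eventually.of_forall fun _ => le_rfl, ?_⟩
    have hhs : 0 ≤ h s := hz.trans hzh.le
    have h1 := hJ.conv_mono z hhs (v := fun _ => u s z) continuousOn_const
      (hsol.continuousOn_slice hs.le) fun y hy => hmin y hy.1 hy.2
    rw [intervalIntegral.integral_mul_const] at h1
    have h2 := hJ.intervalIntegral_sub_le z hhs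
    have h3 := hM (s, z) ⟨⟨hs.le, hst⟩, hz, hzh.le⟩
    have h4 : -M ≤ u s z := (abs_le.1 h3).1
    have h5 := hL (u s z) ⟨h4, hneg.le⟩ 0 ⟨h4.trans hneg.le, le_rfl⟩
    rw [hf.zero, zero_sub, zero_sub, abs_neg, abs_neg, abs_of_neg hneg] at h5
    have h6 := (abs_le.1 h5).1
    have h7 := mul_le_mul_of_nonpos_right h2 hneg.le
    have h8 := mul_le_mul_of_nonneg_left (h7.trans h1) hd.le
    rw [← mul_assoc] at h8
    linarith

/-- Where `u` exceeds the barrier and is maximal in space, dispersal is nonpositive, so `u_t ≤ f(u)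
≤ -κ`, the slope of the barrier. Taking `κ = 0` gives invariant levels; `κ > 0` forces descent. -/
theorem le_affine (hd : 0 < d) (hJ : KernelCond J)
    (hsol : IsSolution d μ J f h₀ u₀ u h) {t₀ t₁ a κ : ℝ} (ht₀ : 0 ≤ t₀) (hκ : 0 ≤ κ)
    (ha : 0 ≤ a - κ * (t₁ - t₀)) (hfκ : ∀ v, a - κ * (t₁ - t₀) < v → f v ≤ -κ)
    (hinit : ∀ x, 0 ≤ x → x ≤ h t₀ → u t₀ x ≤ a) {t x : ℝ} (ht : t₀ ≤ t) (ht' : t ≤ t₁)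
    (hx : 0 ≤ x) (hxh : x ≤ h t) : u t x ≤ a - κ * (t - t₀) := by
  have hh : ContinuousOn h (Icc t₀ t₁) := hsol.h_continuousOn.mono fun s hs => ht₀.trans hs.1
  have hcont := hsol.continuousOn_strip (g := h) (t₁ := t₁) ht₀ fun _ _ _ => le_rfl
  have hV : ∀ s, s ≤ t₁ → a - κ * (t₁ - t₀) ≤ a - κ * (s - t₀) := fun s hs => by
    have := mul_le_mul_of_nonneg_left hs hκ
    linarith
  refine sub_nonneg.1 (minimum_principle (W := fun t x => a - κ * (t - t₀) - u t x) (L := 0) hh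
    ?_ ?_ ?_ ?_ t ht ht' x hx hxh)
  · exact ContinuousOn.sub (by fun_prop) hcont
  · intro y hy hy'
    have := hinit y hy hy'
    simp only [sub_self, mul_zero]
    linarith
  · intro s hs hs'
    rw [hsol.boundary s (ht₀.trans_lt hs), sub_zero]
    exact ha.trans (hV s hs')
  · intro s hs hst z hz hzh hneg hmin
    have hs0 : 0 < s := ht₀.trans_lt hs
    have hd' : HasDerivAt (fun r => a - κ * (r - t₀)) (-κ) s := by
      simpa using (((hasDerivAt_id s).sub_const t₀).const_mul κ).const_sub a
    refine ⟨_, _, hd'.sub (hsol.evolution s z hs0 hz hzh), rfl,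
      Eventually.of_forall fun _ => le_rfl, ?_⟩
    have hhs : 0 ≤ h s := hz.trans hzh.le
    have h1 := hJ.conv_mono z hhs (w := fun _ => u s z)
      (hsol.continuousOn_slice hs0.le) continuousOn_const
      fun y hy => by have := hmin y hy.1 hy.2; linarith
    rw [intervalIntegral.integral_mul_const] at h1
    have h2 := hJ.intervalIntegral_sub_le z hhs
    have h3 : a - κ * (t₁ - t₀) < u s z := (hV s hst).trans_lt (by linarith)
    have h4 := hfκ _ h3
    have h7 := mul_le_mul_of_nonneg_right h2 (ha.trans h3.le)
    have h8 := mul_le_mul_of_nonneg_left (h1.trans h7) hd.le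
    rw [← mul_assoc] at h8
    rw [zero_mul]
    linarith

theorem exists_bound (hd : 0 < d) (hJ : KernelCond J) (hf : GrowthCond f ustar)
    (hu₀ : InitialCond h₀ u₀) (hsol : IsSolution d μ J f h₀ u₀ u h) :
    ∃ M, ustar < M ∧ ∀ t x, 0 ≤ t → 0 ≤ x → x ≤ h t → u t x ≤ M := by
  obtain ⟨C, hC⟩ := isCompact_Icc.exists_bound_of_continuousOn hu₀.continuousOn
  have hM : ustar < max C (ustar + 1) := (lt_add_one ustar).trans_le (le_max_right _ _)
  refine ⟨max C (ustar + 1), hM, fun t x ht hx hxh => ?_⟩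
  have := hsol.le_affine hd hJ (t₀ := 0) (t₁ := t) (a := max C (ustar + 1)) (κ := 0) le_rfl le_rfl
    (by simpa using (hf.ustar_pos.trans hM).le) (fun v hv => ?_) (fun y hy hy' => ?_)
    ht le_rfl hx hxh
  · simpa using this
  · have := hf.neg_of_lt (v := v) (hM.trans (by simpa using hv))
    simpa using this.le
  · rw [hsol.initial_h] at hy'
    rw [hsol.initial_u y ⟨hy, hy'⟩]
    exact (le_abs_self _).trans ((hC y ⟨hy, hy'⟩).trans (le_max_left _ _))

/-- Above `ustar + ε` the reaction is at most `f (ustar + ε) < 0`, so a line of that slope starting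
from the global bound reaches `ustar + ε` at the finite time `T`; from then on the constant is a
barrier. -/
theorem eventually_le (hd : 0 < d) (hJ : KernelCond J) (hf : GrowthCond f ustar)
    (hu₀ : InitialCond h₀ u₀) (hsol : IsSolution d μ J f h₀ u₀ u h) {ε : ℝ} (hε : 0 < ε) :
    ∀ᶠ t in atTop, ∀ x, 0 ≤ x → x ≤ h t → u t x ≤ ustar + ε := by
  obtain ⟨M₀, -, hM₀⟩ := hsol.exists_bound hd hJ hf hu₀
  obtain ⟨M, hMε, hM⟩ : ∃ M, ustar + ε ≤ M ∧ ∀ t x, 0 ≤ t → 0 ≤ x → x ≤ h t → u t x ≤ M :=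
    ⟨max M₀ (ustar + ε), le_max_right _ _,
      fun t x h1 h2 h3 => (hM₀ t x h1 h2 h3).trans (le_max_left _ _)⟩
  have hlt : ustar < ustar + ε := by linarith
  have hκ : 0 < -f (ustar + ε) := neg_pos.2 (hf.neg_of_lt hlt)
  set κ := -f (ustar + ε) with hκdef
  set T := (M - (ustar + ε)) / κ with hTdef
  have hT : 0 ≤ T := div_nonneg (by linarith) hκ.le
  have hMT : M - κ * (T - 0) = ustar + ε := by
    rw [hTdef]; field_simp; ring
  have hpos : 0 < ustar + ε := hf.ustar_pos.trans hlt
  have hT' : ∀ x, 0 ≤ x → x ≤ h T → u T x ≤ ustar + ε := fun x hx hxh => by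
    have := hsol.le_affine hd hJ (t₀ := 0) (t₁ := T) (a := M) (κ := κ) le_rfl hκ.le
      (by rw [hMT]; exact hpos.le)
      (fun v hv => by
        rw [hMT] at hv
        rw [hκdef, neg_neg]
        exact hf.le_of_le hlt hv.le)
      (fun y hy hy' => hM 0 y le_rfl hy hy') hT le_rfl hx hxh
    rwa [hMT] at this
  filter_upwards [eventually_ge_atTop T] with t ht x hx hxh
  have := hsol.le_affine hd hJ (t₀ := T) (t₁ := t) (a := ustar + ε) (κ := 0) hT le_rfl
    (by simpa using hpos.le)
    (fun v hv => by
      have := hf.neg_of_lt (v := v) (hlt.trans (by simpa using hv))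
      simpa using this.le) hT' ht le_rfl hx hxh
  simpa using this

/-- Since `u ≥ 0`, dropping its mass on `[g, h]` only lowers the convolution. At a negative minimum
of `u - v` one has `0 ≤ u < v ≤ B`, so a Lipschitz constant of `f` on `[0, B]` suffices. -/
theorem le_of_subsolution (hd : 0 < d) (hJ : KernelCond J) (hf : GrowthCond f ustar)
    (hu₀ : InitialCond h₀ u₀) (hsol : IsSolution d μ J f h₀ u₀ u h)
    {v : ℝ → ℝ → ℝ} {g : ℝ → ℝ} {t₀ t₁ B : ℝ} (ht₀ : 0 ≤ t₀)
    (hg : ContinuousOn g (Icc t₀ t₁)) (hgh : ∀ t, t₀ ≤ t → t ≤ t₁ → g t ≤ h t)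
    (hv : ContinuousOn (fun p : ℝ × ℝ => v p.1 p.2)
      {p | (t₀ ≤ p.1 ∧ p.1 ≤ t₁) ∧ 0 ≤ p.2 ∧ p.2 ≤ g p.1})
    (hg0 : ∀ t, t₀ ≤ t → 0 ≤ g t)
    (hvB : ∀ t x, v t x ≤ B) (hv0 : ∀ t, t₀ ≤ t → v t (g t) = 0)
    (hinit : ∀ x, 0 ≤ x → x ≤ g t₀ → v t₀ x ≤ u t₀ x)
    (hstep : ∀ t, t₀ < t → ∀ x, 0 ≤ x → x < g t →
      ∃ (φ : ℝ → ℝ) (D : ℝ), HasDerivAt φ D t ∧ φ t = v t x ∧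
        (∀ᶠ s in 𝓝[<] t, φ s ≤ v s x) ∧
        D ≤ d * (∫ y in (0 : ℝ)..(g t), J (x - y) * v t y)
          - d * (∫ y in Ioi (0 : ℝ), J (x - y)) * v t x + f (v t x))
    {t x : ℝ} (ht : t₀ ≤ t) (ht' : t ≤ t₁) (hx : 0 ≤ x) (hxg : x ≤ g t) : v t x ≤ u t x := by
  obtain ⟨L, hL0, hL⟩ := hf.exists_lipschitz 0 B
  have hcont := hsol.continuousOn_strip ht₀ hgh
  refine sub_nonneg.1 (minimum_principle (W := fun t x => u t x - v t x) (L := L) hg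
    (hcont.sub hv) ?_ ?_ ?_ t ht ht' x hx hxg)
  · exact fun y hy hy' => sub_nonneg.2 (hinit y hy hy')
  · intro s hs hs'
    simp only [hv0 s hs.le, sub_zero]
    exact hsol.nonneg hd hJ hf hu₀ (ht₀.trans hs.le) (hg0 s hs.le) (hgh s hs.le hs')
  · intro s hs hst z hz hzg hneg hmin
    have hs0 : 0 < s := ht₀.trans_lt hs
    have hghs := hgh s hs.le hst
    obtain ⟨φ, D, hφ, hφs, hφle, hD⟩ := hstep s hs z hz hzg
    refine ⟨_, _, (hsol.evolution s z hs0 hz (hzg.trans_le hghs)).sub hφ, ?_, ?_, ?_⟩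
    · simp only [Pi.sub_apply, hφs]
    · filter_upwards [hφle] with r hr
      simp only [Pi.sub_apply]
      linarith
    have hus : ∀ y, 0 ≤ y → y ≤ h s → 0 ≤ u s y := fun y hy hy' =>
      hsol.nonneg hd hJ hf hu₀ hs0.le hy hy'
    have hgs := hg0 s hs.le
    have hslice := hsol.continuousOn_slice hs0.le
    have hvs : ContinuousOn (v s) (Icc 0 (g s)) :=
      hv.comp (f := fun x : ℝ => (s, x)) (by fun_prop) fun _ hx => ⟨⟨hs.le, hst⟩, hx.1, hx.2⟩
    have hJc : Continuous fun y => J (z - y) := hJ.continuous.comp (by fun_prop)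
    have hI : IntervalIntegrable (fun y => J (z - y) * u s y) volume 0 (h s) :=
      (hJc.continuousOn.mul hslice).intervalIntegrable_of_Icc (hgs.trans hghs)
    have h0 : ∫ y in (0 : ℝ)..(g s), J (z - y) * u s y ≤
        ∫ y in (0 : ℝ)..(h s), J (z - y) * u s y := by
      refine intervalIntegral.integral_mono_interval le_rfl hgs hghs ?_ hI
      refine (ae_restrict_iff' measurableSet_Ioc).2 (ae_of_all _ fun y hy => ?_)
      exact mul_nonneg (hJ.nonneg _) (hus y hy.1.le hy.2)
    set m := u s z - v s z with hm
    have h1 := hJ.conv_mono z hgs (v := fun y => v s y + m) (hvs.add continuousOn_const)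
      (hslice.mono (Icc_subset_Icc_right hghs)) fun y hy => by
        have := hmin y hy.1 hy.2; linarith
    have h1' : ∫ y in (0 : ℝ)..(g s), J (z - y) * (v s y + m) =
        (∫ y in (0 : ℝ)..(g s), J (z - y) * v s y) + (∫ y in (0 : ℝ)..(g s), J (z - y)) * m := by
      rw [← intervalIntegral.integral_mul_const, ← intervalIntegral.integral_add]
      · simp only [mul_add]
      · exact (hJc.continuousOn.mul hvs).intervalIntegrable_of_Icc hgs
      · exact (hJc.mul continuous_const).intervalIntegrable _ _
    rw [h1'] at h1
    have h2 := hJ.intervalIntegral_sub_le z hgs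
    have h3 := mul_le_mul_of_nonpos_right h2 (show m ≤ 0 from hneg.le)
    have hu0 := hus z hz (hzg.le.trans hghs)
    have h5 := hL (v s z) ⟨by linarith, hvB s z⟩ (u s z) ⟨hu0, by linarith [hvB s z]⟩
    rw [← hm, abs_of_neg (show m < 0 from hneg)] at h5
    have h6 := (abs_le.1 h5).1
    have h8 := mul_le_mul_of_nonneg_left ((add_le_add_right h3 _).trans (h1.trans h0)) hd.le
    have h9 : d * (∫ y in Ioi (0 : ℝ), J (z - y)) * u s z =
        d * (∫ y in Ioi (0 : ℝ), J (z - y)) * v s z + d * ((∫ y in Ioi (0 : ℝ), J (z - y)) * m) := by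
      rw [hm]; ring
    rw [h9]
    rw [mul_add] at h8
    linarith

theorem flux_eq (hJ : KernelCond J) (t : ℝ) :
    ∫ x in (0 : ℝ)..(h t), ∫ y in Ioi (h t), J (x - y) * u t x =
      ∫ x in (0 : ℝ)..(h t), tail J (h t - x) * u t x := by
  simp only [integral_mul_const, hJ.setIntegral_Ioi_sub]

/-- Comparison of the free boundary problem with a strict lower solution `(v, g)`. -/
theorem lower_solution (hd : 0 < d) (hμ : 0 < μ) (hJ : KernelCond J) (hf : GrowthCond f ustar)
    (hu₀ : InitialCond h₀ u₀) (hsol : IsSolution d μ J f h₀ u₀ u h)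
    {v : ℝ → ℝ → ℝ} {g g' : ℝ → ℝ} {t₀ B : ℝ} (ht₀ : 0 ≤ t₀)
    (hg : ∀ t, t₀ ≤ t → HasDerivAt g (g' t) t)
    (hv : ContinuousOn (fun p : ℝ × ℝ => v p.1 p.2) {p | t₀ ≤ p.1 ∧ 0 ≤ p.2 ∧ p.2 ≤ g p.1})
    (hg0 : ∀ t, t₀ ≤ t → 0 ≤ g t)
    (hvB : ∀ t x, v t x ≤ B) (hv0 : ∀ t, t₀ ≤ t → v t (g t) = 0)
    (hgh : g t₀ < h t₀) (hinit : ∀ x, 0 ≤ x → x ≤ g t₀ → v t₀ x ≤ u t₀ x)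
    (hstep : ∀ t, t₀ < t → ∀ x, 0 ≤ x → x < g t →
      ∃ (φ : ℝ → ℝ) (D : ℝ), HasDerivAt φ D t ∧ φ t = v t x ∧
        (∀ᶠ s in 𝓝[<] t, φ s ≤ v s x) ∧
        D ≤ d * (∫ y in (0 : ℝ)..(g t), J (x - y) * v t y)
          - d * (∫ y in Ioi (0 : ℝ), J (x - y)) * v t x + f (v t x))
    (hflux : ∀ t, t₀ < t → g' t < μ * ∫ x in (0 : ℝ)..(g t), tail J (g t - x) * v t x)
    {t : ℝ} (ht : t₀ ≤ t) : g t ≤ h t ∧ ∀ x, 0 ≤ x → x ≤ g t → v t x ≤ u t x := by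
  have hgc : ∀ t₁, ContinuousOn g (Icc t₀ t₁) := fun t₁ s hs =>
    (hg s hs.1).continuousAt.continuousWithinAt
  have hhc : ∀ t₁, ContinuousOn h (Icc t₀ t₁) := fun t₁ =>
    hsol.h_continuousOn.mono fun s hs => ht₀.trans hs.1
  have key : ∀ t₁, (∀ s, t₀ ≤ s → s ≤ t₁ → g s ≤ h s) → ∀ s, t₀ ≤ s → s ≤ t₁ →
      ∀ x, 0 ≤ x → x ≤ g s → v s x ≤ u s x := fun t₁ hle s hs hs' x hx hxg =>
    hsol.le_of_subsolution hd hJ hf hu₀ ht₀ (hgc t₁) hle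
      (hv.mono fun p hp => ⟨hp.1.1, hp.2⟩) hg0 hvB hv0 hinit hstep hs hs' hx hxg
  have hlt : ∀ s, t₀ ≤ s → g s < h s := by
    by_contra! hcon
    obtain ⟨t₁, ht₁, hht₁⟩ := hcon
    have hcl : IsClosed (Icc t₀ t₁ ∩ (fun s => g s - h s) ⁻¹' Ici 0) :=
      ((hgc t₁).sub (hhc t₁)).preimage_isClosed_of_isClosed isClosed_Icc isClosed_Ici
    have hK : IsCompact (Icc t₀ t₁ ∩ (fun s => g s - h s) ⁻¹' Ici 0) :=
      isCompact_Icc.of_isClosed_subset hcl inter_subset_left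
    -- `τ` is the first contact time of the two fronts.
    obtain ⟨τ, ⟨⟨hτ0, hτ1⟩, hτ⟩, hleast⟩ :=
      hK.exists_isLeast ⟨t₁, ⟨ht₁, le_rfl⟩, by simpa using hht₁⟩
    have hτ' : h τ ≤ g τ := by simpa using hτ
    have hbefore : ∀ s, t₀ ≤ s → s < τ → g s < h s := fun s hs hsτ => by
      by_contra! hc
      exact absurd (hleast ⟨⟨hs, hsτ.le.trans hτ1⟩, by simpa using hc⟩) (not_le.2 hsτ)
    have hτpos : t₀ < τ := by
      rcases hτ0.lt_or_eq with h1 | h1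
      · exact h1
      · rw [← h1] at hτ'
        exact absurd hgh (not_lt.2 hτ')
    have hev : ∀ᶠ s in 𝓝[<] τ, g s < h s := by
      rw [← nhdsWithin_Ioo_eq_nhdsLT hτpos]
      filter_upwards [self_mem_nhdsWithin] with s hs
      exact hbefore s hs.1.le hs.2
    have hdh := hsol.free_boundary τ (ht₀.trans_lt hτpos)
    have heq : g τ = h τ := by
      refine le_antisymm ?_ hτ'
      exact le_of_tendsto_of_tendsto
        ((hg τ hτ0).continuousAt.tendsto.mono_left nhdsWithin_le_nhds)
        (hdh.continuousAt.tendsto.mono_left nhdsWithin_le_nhds) (hev.mono fun s hs => hs.le)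
    have hle : ∀ s, t₀ ≤ s → s ≤ τ → g s ≤ h s := fun s hs hs' => by
      rcases hs'.lt_or_eq with h1 | h1
      · exact (hbefore s hs h1).le
      · rw [h1, heq]
    -- At contact `h - g` falls to zero, so `h' ≤ g'`; but `v ≤ u` up to `τ` and the strict flux
    -- inequality give `g' < h'`.
    have hfin := hasDerivAt_nonpos_of_left (hdh.sub (hg τ hτ0)) (by
      filter_upwards [hev] with s hs
      simp only [Pi.sub_apply, heq, sub_self]
      linarith)
    rw [flux_eq hJ, ← heq] at hfin
    have hgτ := hg0 τ hτ0
    have hvτ : ContinuousOn (v τ) (Icc 0 (g τ)) :=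
      hv.comp (f := fun x : ℝ => (τ, x)) (by fun_prop) fun _ hx => ⟨hτ0, hx.1, hx.2⟩
    have huτ : ContinuousOn (u τ) (Icc 0 (g τ)) := by
      rw [heq]; exact hsol.continuousOn_slice (ht₀.trans hτ0)
    have hTc : ContinuousOn (fun x => tail J (g τ - x)) (Icc 0 (g τ)) :=
      (hJ.continuous_tail.comp (by fun_prop)).continuousOn
    have hmono : ∫ x in (0 : ℝ)..(g τ), tail J (g τ - x) * v τ x ≤
        ∫ x in (0 : ℝ)..(g τ), tail J (g τ - x) * u τ x :=
      intervalIntegral.integral_mono_on hgτ ((hTc.mul hvτ).intervalIntegrable_of_Icc hgτ)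
        ((hTc.mul huτ).intervalIntegrable_of_Icc hgτ) fun x hx =>
        mul_le_mul_of_nonneg_left (key τ hle τ hτ0 le_rfl x hx.1 hx.2) (hJ.tail_nonneg _)
    have := mul_le_mul_of_nonneg_left hmono hμ.le
    linarith [hflux τ hτpos]
  exact ⟨(hlt t ht).le, key t (fun s hs _ => (hlt s hs).le) t ht le_rfl⟩

end IsSolution

end

/-! ### The ramp profile -/

/-- The ramp profile of height `A`, front `g` and width `w`. -/
noncomputable def ramp (A g w y : ℝ) : ℝ := A * max 0 (min 1 ((g - y) / w))

section

variable {A g w x y : ℝ}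

theorem continuous_ramp (A g w : ℝ) : Continuous (ramp A g w) := by
  unfold ramp; fun_prop

theorem ramp_nonneg (hA : 0 ≤ A) : 0 ≤ ramp A g w y := mul_nonneg hA (le_max_left _ _)

theorem ramp_le (hA : 0 ≤ A) : ramp A g w y ≤ A :=
  mul_le_of_le_one_right hA (max_le zero_le_one (min_le_left _ _))

theorem ramp_antitone (hA : 0 ≤ A) (hw : 0 < w) : Antitone (ramp A g w) := fun a b hab => by
  unfold ramp
  gcongr

theorem ramp_eq_of_le (hw : 0 < w) (hy : y ≤ g - w) : ramp A g w y = A := by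
  have : 1 ≤ (g - y) / w := by rw [le_div_iff₀ hw]; linarith
  simp [ramp, this]

theorem ramp_eq_zero (hw : 0 < w) (hy : g ≤ y) : ramp A g w y = 0 := by
  have : (g - y) / w ≤ 0 := div_nonpos_of_nonpos_of_nonneg (by linarith) hw.le
  simp [ramp, this]

theorem ramp_eq_linear (hw : 0 < w) (hy : g - w ≤ y) (hyg : y ≤ g) :
    ramp A g w y = A / w * (g - y) := by
  have h1 : (g - y) / w ≤ 1 := by rw [div_le_iff₀ hw]; linarith
  have h2 : 0 ≤ (g - y) / w := div_nonneg (by linarith) hw.le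
  rw [ramp, min_eq_right h1, max_eq_right h2]; ring

theorem linear_le_ramp (hA : 0 ≤ A) (hw : 0 < w) (hy : g - w ≤ y) :
    A / w * (g - y) ≤ ramp A g w y := by
  have h1 : (g - y) / w ≤ 1 := by rw [div_le_iff₀ hw]; linarith
  rw [ramp, min_eq_right h1, div_mul_eq_mul_div, mul_div_assoc]
  exact mul_le_mul_of_nonneg_left (le_max_right _ _) hA

theorem ramp_sub_ge (hA : 0 ≤ A) (hw : 0 < w) :
    -(A * min 1 (|y - x| / w)) ≤ ramp A g w y - ramp A g w x := by
  have key : max 0 (min 1 ((g - x) / w)) ≤ max 0 (min 1 ((g - y) / w)) + min 1 (|y - x| / w) := by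
    have hm : 0 ≤ min 1 (|y - x| / w) := le_min zero_le_one (by positivity)
    have h1 : (g - x) / w ≤ (g - y) / w + |y - x| / w := by
      rw [← add_div]
      gcongr
      linarith [le_abs_self (y - x)]
    refine max_le (add_nonneg (le_max_left _ _) hm) ?_
    rcases le_total 1 (|y - x| / w) with h | h
    · rw [min_eq_left h]
      linarith [min_le_left 1 ((g - x) / w), le_max_left 0 (min 1 ((g - y) / w))]
    · rw [min_eq_right h]
      have h3 : (0 : ℝ) ≤ |y - x| / w := by positivity
      rcases le_total 1 ((g - y) / w) with h2 | h2
      · rw [min_eq_left h2]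
        linarith [min_le_left 1 ((g - x) / w), le_max_right (0 : ℝ) 1]
      · rw [min_eq_right h2]
        linarith [min_le_right 1 ((g - x) / w), le_max_right 0 ((g - y) / w)]
  have := mul_le_mul_of_nonneg_left key hA
  unfold ramp
  linarith

end

/-! ### The nonlocal operator and the flux on a ramp -/

namespace KernelCond

variable {J : ℝ → ℝ}

theorem integrable_sub_mul (hJ : KernelCond J) (x : ℝ) {v : ℝ → ℝ} (hv : Continuous v) {C : ℝ}
    (hC : ∀ y, |v y| ≤ C) : Integrable fun y => J (x - y) * v y :=
  (hJ.integrable_sub x).mul_bdd hv.aestronglyMeasurable (ae_of_all _ hC)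

theorem conv_ramp_sub (hJ : KernelCond J) {A g w : ℝ} (hA : 0 ≤ A) (hw : 0 < w) (hg : 0 ≤ g)
    (x : ℝ) :
    (∫ y in (0 : ℝ)..g, J (x - y) * ramp A g w y)
      - (∫ y in Ioi (0 : ℝ), J (x - y)) * ramp A g w x
      = ∫ y in Ioi (0 : ℝ), J (x - y) * (ramp A g w y - ramp A g w x) := by
  have hI := hJ.integrable_sub_mul x (continuous_ramp A g w) (C := A) fun y => by
    rw [abs_of_nonneg (ramp_nonneg hA)]; exact ramp_le hA
  have h1 : ∫ y in (0 : ℝ)..g, J (x - y) * ramp A g w y =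
      ∫ y in Ioi (0 : ℝ), J (x - y) * ramp A g w y := by
    rw [intervalIntegral.integral_of_le hg]
    refine (setIntegral_eq_of_subset_of_forall_sdiff_eq_zero measurableSet_Ioi
      Ioc_subset_Ioi_self fun y hy => ?_).symm
    have hgy : g ≤ y := by
      by_contra! h
      exact hy.2 ⟨hy.1, h.le⟩
    rw [ramp_eq_zero hw hgy, mul_zero]
  rw [h1, ← integral_mul_const, ← integral_sub hI.integrableOn
    ((hJ.integrable_sub x).mul_const _).integrableOn]
  simp only [mul_sub]

/-- A lower bound of the nonlocal operator by a translation invariant minorant. -/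
theorem conv_ramp_ge (hJ : KernelCond J) {A g w : ℝ} (hA : 0 ≤ A) {x : ℝ}
    {Q : ℝ → ℝ} (hQ : Integrable fun z => J z * Q z)
    (hpos : ∀ y, 0 < y → Q (y - x) ≤ ramp A g w y - ramp A g w x)
    (hneg : ∀ y, y ≤ 0 → Q (y - x) ≤ 0) :
    ∫ z, J z * Q z ≤ ∫ y in Ioi (0 : ℝ), J (x - y) * (ramp A g w y - ramp A g w x) := by
  have hI : Integrable fun y => J (x - y) * (ramp A g w y - ramp A g w x) :=
    hJ.integrable_sub_mul x ((continuous_ramp A g w).sub continuous_const) (C := A) fun y =>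
      abs_sub_le_of_nonneg_of_le (ramp_nonneg hA) (ramp_le hA) (ramp_nonneg hA) (ramp_le hA)
  rw [← integral_sub_right_eq_self _ x, ← integral_indicator measurableSet_Ioi]
  refine integral_mono (hQ.comp_sub_right x) (hI.indicator measurableSet_Ioi) fun y => ?_
  simp only [indicator, mem_Ioi]
  split_ifs with h
  · rw [hJ.comp_sub x y]
    exact mul_le_mul_of_nonneg_left (hpos y h) (hJ.nonneg _)
  · exact mul_nonpos_of_nonneg_of_nonpos (hJ.nonneg _) (hneg y (not_lt.1 h))

theorem integrable_mul_min (hJ : KernelCond J) {w : ℝ} (hw : 0 < w) :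
    Integrable fun z => J z * min 1 (|z| / w) :=
  hJ.integrable.mul_bdd (c := 1) (by fun_prop) (ae_of_all _ fun z => by
    rw [Real.norm_of_nonneg (le_min zero_le_one (by positivity))]
    exact min_le_left _ _)

/-- The truncation at `1` lets `J` itself dominate; the first moment of `J` may be infinite. -/
theorem tendsto_integral_mul_min (hJ : KernelCond J) :
    Tendsto (fun w => ∫ z, J z * min 1 (|z| / w)) atTop (𝓝 0) := by
  have := tendsto_integral_filter_of_dominated_convergence (μ := volume) (l := atTop)
    (F := fun (w : ℝ) z => J z * min 1 (|z| / w)) (f := fun _ => 0) J ?_ ?_ hJ.integrable ?_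
  · simpa using this
  · filter_upwards [eventually_gt_atTop 0] with w hw
    exact (hJ.integrable_mul_min hw).aestronglyMeasurable
  · filter_upwards [eventually_gt_atTop 0] with w hw
    refine ae_of_all _ fun z => ?_
    rw [Real.norm_of_nonneg (mul_nonneg (hJ.nonneg _) (le_min zero_le_one (by positivity)))]
    exact mul_le_of_le_one_right (hJ.nonneg _) (min_le_left _ _)
  · refine ae_of_all _ fun z => ?_
    have h1 : Tendsto (fun w : ℝ => |z| / w) atTop (𝓝 0) :=
      tendsto_const_nhds.div_atTop tendsto_id
    have h2 : Tendsto (fun w : ℝ => min 1 (|z| / w)) atTop (𝓝 (min 1 0)) :=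
      tendsto_const_nhds.min h1
    simpa using h2.const_mul (J z)

theorem conv_ramp_ge_small (hJ : KernelCond J) {A g w : ℝ} (hA : 0 ≤ A) (hw : 0 < w) (x : ℝ) :
    -(A * ∫ z, J z * min 1 (|z| / w)) ≤
      ∫ y in Ioi (0 : ℝ), J (x - y) * (ramp A g w y - ramp A g w x) := by
  have heq : ∀ z, J z * -(A * min 1 (|z| / w)) = -A * (J z * min 1 (|z| / w)) := fun z => by ring
  have h1 : ∫ z, J z * -(A * min 1 (|z| / w)) = -(A * ∫ z, J z * min 1 (|z| / w)) := by
    simp only [heq]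
    rw [integral_const_mul, neg_mul]
  rw [← h1]
  refine hJ.conv_ramp_ge hA ?_ (fun y _ => ramp_sub_ge hA hw) fun y _ => ?_
  · simp only [heq]
    exact (hJ.integrable_mul_min hw).const_mul _
  · exact neg_nonpos.2 (mul_nonneg hA (le_min zero_le_one (by positivity)))

/-- The gain of the nonlocal operator at the foot of the ramp, due to convexity there. -/
theorem conv_ramp_ge_foot (hJ : KernelCond J) {A g w x b : ℝ} (hA : 0 ≤ A) (hw : 0 < w)
    (hxg : x ≤ g) (hxw : g - w / 2 ≤ x) (hx : w / 2 < x) (hxb : g - x ≤ b) :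
    A / w * (∫ z in Icc (2 * b) (w / 2), J z * (z / 2)) - ramp A g w x * tail J (w / 2) ≤
      ∫ y in Ioi (0 : ℝ), J (x - y) * (ramp A g w y - ramp A g w x) := by
  have hJc := hJ.continuous
  set S₁ := Icc (-(w / 2)) (w / 2)
  set S₂ := Icc (2 * b) (w / 2)
  set S₃ := Ioi (w / 2)
  set F₁ : ℝ → ℝ := S₁.indicator fun z => J z * z with hF₁
  set F₂ : ℝ → ℝ := S₂.indicator fun z => J z * (z / 2) with hF₂
  set F₃ : ℝ → ℝ := S₃.indicator J with hF₃
  have hI₁ : Integrable F₁ := by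
    refine IntegrableOn.integrable_indicator ?_ measurableSet_Icc
    exact (hJc.mul continuous_id).continuousOn.integrableOn_Icc
  have hI₂ : Integrable F₂ := by
    refine IntegrableOn.integrable_indicator ?_ measurableSet_Icc
    exact (hJc.mul (by fun_prop)).continuousOn.integrableOn_Icc
  have hI₃ : Integrable F₃ := hJ.integrable.indicator measurableSet_Ioi
  -- Evenness of `J` cancels the linear part of the ramp on a symmetric window.
  have hodd : ∫ z, F₁ z = 0 := by
    have h1 : ∀ z, F₁ (-z) = -F₁ z := fun z => by
      have : -z ∈ S₁ ↔ z ∈ S₁ := by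
        simp only [S₁, mem_Icc]
        constructor <;> rintro ⟨h1, h2⟩ <;> constructor <;> linarith
      simp only [hF₁, indicator, this, hJ.even]
      split_ifs <;> simp
    have h2 := integral_neg_eq_self F₁ volume
    simp only [h1, integral_neg] at h2
    linarith
  -- The minorant is the linear decrement `-(A/w) z` on `|z| ≤ w/2`, corrected by `(A/w) z/2` for `z
  -- ≥ 2b`: there the true loss is at most the height `(A/w)(g - x) ≤ (A/w) b ≤ (A/w) z/2`, because
  -- the ramp stops at zero. Longer outward jumps lose at most the whole height, longer inward ones
  -- lose nothing.
  set Q : ℝ → ℝ := fun z => -(A / w) * S₁.indicator (fun z => z) z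
    + A / w * S₂.indicator (fun z => z / 2) z - ramp A g w x * S₃.indicator (fun _ => 1) z with hQ
  have hJQ : ∀ z, J z * Q z = -(A / w) * F₁ z + A / w * F₂ z - ramp A g w x * F₃ z := fun z => by
    simp only [hQ, hF₁, hF₂, hF₃, indicator]
    split_ifs <;> ring
  have hint : ∫ z, J z * Q z =
      A / w * (∫ z in S₂, J z * (z / 2)) - ramp A g w x * tail J (w / 2) := by
    have hI₁₂ : Integrable fun z => -(A / w) * F₁ z + A / w * F₂ z :=
      (hI₁.const_mul _).add (hI₂.const_mul _)
    simp only [hJQ]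
    rw [integral_sub hI₁₂ (hI₃.const_mul _),
      integral_add (hI₁.const_mul _) (hI₂.const_mul _), integral_const_mul, integral_const_mul,
      integral_const_mul, hodd, hF₂, hF₃, integral_indicator measurableSet_Icc,
      integral_indicator measurableSet_Ioi, mul_zero, zero_add, tail]
  rw [← hint]
  have hAw : 0 ≤ A / w := div_nonneg hA hw.le
  have hPx : ramp A g w x = A / w * (g - x) := ramp_eq_linear hw (by linarith) hxg
  have hb : 0 ≤ b := by linarith
  refine hJ.conv_ramp_ge hA ?_ (fun y hy => ?_) fun y hy => ?_
  · simp only [hJQ]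
    exact ((hI₁.const_mul _).add (hI₂.const_mul _)).sub (hI₃.const_mul _)
  · have hP0 := ramp_nonneg (g := g) (w := w) (y := y) hA
    rcases lt_or_ge (w / 2) (y - x) with h1 | h1
    · have e₁ : y - x ∉ S₁ := fun h => absurd h.2 (not_le.2 h1)
      have e₂ : y - x ∉ S₂ := fun h => absurd h.2 (not_le.2 h1)
      have e₃ : y - x ∈ S₃ := h1
      simp only [hQ, indicator_of_notMem e₁, indicator_of_notMem e₂, indicator_of_mem e₃]
      linarith
    have e₃ : y - x ∉ S₃ := not_lt.2 h1
    rcases lt_or_ge (y - x) (-(w / 2)) with h2 | h2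
    · have e₁ : y - x ∉ S₁ := fun h => absurd h.1 (not_le.2 h2)
      have e₂ : y - x ∉ S₂ := fun h => absurd h.1 (not_le.2 (by linarith))
      simp only [hQ, indicator_of_notMem e₁, indicator_of_notMem e₂, indicator_of_notMem e₃]
      have := ramp_antitone (g := g) hA hw (show y ≤ x by linarith)
      linarith
    have e₁ : y - x ∈ S₁ := ⟨h2, h1⟩
    by_cases e₂ : y - x ∈ S₂
    · simp only [hQ, indicator_of_mem e₁, indicator_of_mem e₂, indicator_of_notMem e₃, hPx]
      have h3 : 2 * b ≤ y - x := e₂.1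
      have := mul_le_mul_of_nonneg_left (show g - x ≤ (y - x) / 2 by linarith) hAw
      linarith
    · simp only [hQ, indicator_of_mem e₁, indicator_of_notMem e₂, indicator_of_notMem e₃, hPx]
      have := linear_le_ramp (g := g) (y := y) hA hw (by linarith)
      linarith
  · have e₁ : y - x ∉ S₁ := fun h => absurd h.1 (not_le.2 (by linarith))
    have e₂ : y - x ∉ S₂ := fun h => absurd h.1 (not_le.2 (by linarith))
    have e₃ : y - x ∉ S₃ := fun h => absurd (mem_Ioi.1 h) (not_lt.2 (by linarith))
    simp [hQ, e₁, e₂, e₃]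

/-- Only the plateau `[0, g - w]` is kept; reflection about the front turns it into `[w, g]`. -/
theorem flux_ramp_ge (hJ : KernelCond J) {A g w : ℝ} (hA : 0 ≤ A) (hw : 0 < w) (hwg : w ≤ g) :
    A * ∫ z in w..g, tail J z ≤ ∫ x in (0 : ℝ)..g, tail J (g - x) * ramp A g w x := by
  have hc : Continuous fun x => tail J (g - x) * ramp A g w x :=
    (hJ.continuous_tail.comp (by fun_prop)).mul (continuous_ramp A g w)
  have h1 : ∫ x in (0 : ℝ)..(g - w), tail J (g - x) * ramp A g w x ≤
      ∫ x in (0 : ℝ)..g, tail J (g - x) * ramp A g w x :=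
    intervalIntegral.integral_mono_interval le_rfl (by linarith) (by linarith)
      (ae_of_all _ fun x => mul_nonneg (hJ.tail_nonneg _) (ramp_nonneg hA))
      (hc.intervalIntegrable _ _)
  have h2 : ∫ x in (0 : ℝ)..(g - w), tail J (g - x) * ramp A g w x =
      ∫ x in (0 : ℝ)..(g - w), tail J (g - x) * A := by
    refine intervalIntegral.integral_congr fun x hx => ?_
    rw [uIcc_of_le (by linarith)] at hx
    simp only [ramp_eq_of_le hw hx.2]
  rw [h2, intervalIntegral.integral_mul_const,
    intervalIntegral.integral_comp_sub_left (fun z => tail J z) g, sub_sub_cancel, sub_zero] at h1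
  linarith

end KernelCond

/-- The stationary part of the lower solution inequality for the ramp profile. -/
theorem exists_ramp_width {d ustar : ℝ} {J f : ℝ → ℝ} (hd : 0 < d) (hJ : KernelCond J)
    (hf : GrowthCond f ustar) {A : ℝ} (hA : 0 < A) (hAu : A < ustar) :
    ∃ W₀ : ℝ, 0 < W₀ ∧ ∀ w, W₀ ≤ w → ∀ g, 2 * w ≤ g → ∀ b, 0 ≤ b → b ≤ w / 2 →
      ∀ x, 0 ≤ x → x < g →
      A / w * min (f A / A * b / 2) (d * ∫ z in Icc (2 * b) (w / 2), J z * (z / 2)) / 2 ≤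
        d * (∫ y in (0 : ℝ)..g, J (x - y) * ramp A g w y)
          - d * (∫ y in Ioi (0 : ℝ), J (x - y)) * ramp A g w x + f (ramp A g w x) := by
  set δ := f A / A with hδdef
  have hδ : 0 < δ := div_pos (hf.pos_of_lt hA hAu) hA
  -- For large `w` either dispersal loss takes at most half of the reaction `δ P`: the first where
  -- `P ≥ A/2`, the second on the lower half of the ramp.
  have h1 : ∀ᶠ w in atTop, ∫ z, J z * min 1 (|z| / w) < δ / (4 * d) :=
    hJ.tendsto_integral_mul_min.eventually (gt_mem_nhds (by positivity))
  have h2 : ∀ᶠ w in atTop, tail J (w / 2) < δ / (2 * d) :=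
    (hJ.tendsto_tail.comp (tendsto_id.atTop_div_const two_pos)).eventually
      (gt_mem_nhds (by positivity))
  obtain ⟨W₁, hW₁⟩ := eventually_atTop.1 (h1.and h2)
  refine ⟨max W₁ 1, lt_max_of_lt_right one_pos, fun w hw g hg b hb hbw x hx hxg => ?_⟩
  obtain ⟨hη, hT⟩ := hW₁ w ((le_max_left _ _).trans hw)
  have hw0 : 0 < w := one_pos.trans_le ((le_max_right _ _).trans hw)
  have hη' : d * ∫ z, J z * min 1 (|z| / w) ≤ δ / 4 := by
    rw [lt_div_iff₀ (by positivity)] at hη; linarith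
  have hT' : d * tail J (w / 2) ≤ δ / 2 := by
    rw [lt_div_iff₀ (by positivity)] at hT; linarith
  set P := ramp A g w x with hP
  have hP0 : 0 ≤ P := ramp_nonneg hA.le
  have hPA : P ≤ A := ramp_le hA.le
  have hfP : δ * P ≤ f P := hf.chord_le hA hP0 hPA
  have hAw : 0 < A / w := div_pos hA hw0
  have hrw : d * (∫ y in (0 : ℝ)..g, J (x - y) * ramp A g w y)
      - d * (∫ y in Ioi (0 : ℝ), J (x - y)) * P + f P =
      d * (∫ y in Ioi (0 : ℝ), J (x - y) * (ramp A g w y - P)) + f P := by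
    rw [hP, ← hJ.conv_ramp_sub hA.le hw0 (by linarith) x]; ring
  rw [hrw]
  have hint0 : ∀ c, 0 ≤ c → 0 ≤ ∫ z in Icc (2 * c) (w / 2), J z * (z / 2) := fun c hc =>
    setIntegral_nonneg measurableSet_Icc fun z hz =>
      mul_nonneg (hJ.nonneg _) (by have := hz.1; linarith)
  rcases le_or_gt (w / 2) (g - x) with hc | hc
  · have h3 := mul_le_mul_of_nonneg_left (hJ.conv_ramp_ge_small (g := g) hA.le hw0 x) hd.le
    have h4 : A / 2 ≤ P := by
      have := ramp_antitone (g := g) hA.le hw0 (show x ≤ g - w / 2 by linarith)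
      rw [ramp_eq_linear hw0 (by linarith) (by linarith)] at this
      refine le_trans (le_of_eq ?_) this
      field_simp; ring
    have h5 : A / w * min (δ * b / 2) (d * ∫ z in Icc (2 * b) (w / 2), J z * (z / 2)) / 2 ≤
        A / w * (δ * (w / 2) / 2) / 2 := by
      gcongr
      exact (min_le_left _ _).trans (by gcongr)
    have h6 : A / w * (δ * (w / 2) / 2) / 2 = A * δ / 8 := by field_simp; norm_num
    have h7 := mul_le_mul_of_nonneg_left h4 hδ.le
    have h8 := mul_le_mul_of_nonneg_left hη' hA.le
    have h9 : 0 < A * δ := mul_pos hA hδ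
    linarith
  have hPx : P = A / w * (g - x) := ramp_eq_linear hw0 (by linarith) hxg.le
  have hPT := mul_le_mul_of_nonneg_left hT' hP0
  rcases le_or_gt (g - x) b with hxb | hxb
  · have h3 := mul_le_mul_of_nonneg_left
      (hJ.conv_ramp_ge_foot hA.le hw0 hxg.le (by linarith) (by linarith) hxb) hd.le
    have h4 := mul_le_mul_of_nonneg_left (min_le_right (δ * b / 2)
      (d * ∫ z in Icc (2 * b) (w / 2), J z * (z / 2))) hAw.le
    have h5 : 0 ≤ A / w * (d * ∫ z in Icc (2 * b) (w / 2), J z * (z / 2)) :=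
      mul_nonneg hAw.le (mul_nonneg hd.le (hint0 b hb))
    have h6 := mul_nonneg hδ.le hP0
    rw [← hP] at h3
    linarith
  -- With `b := w / 2` the gain interval `[w, w/2]` is empty, so only the tail loss remains; the
  -- surviving half of the reaction is used.
  · have h3 := mul_le_mul_of_nonneg_left (hJ.conv_ramp_ge_foot (b := w / 2) hA.le hw0 hxg.le
      (by linarith) (by linarith) hc.le) hd.le
    have h3' : 0 ≤ d * (A / w * ∫ z in Icc (2 * (w / 2)) (w / 2), J z * (z / 2)) :=
      mul_nonneg hd.le (mul_nonneg hAw.le (hint0 _ (by linarith)))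
    have h4 := mul_le_mul_of_nonneg_left (min_le_left (δ * b / 2)
      (d * ∫ z in Icc (2 * b) (w / 2), J z * (z / 2))) hAw.le
    have h5 := mul_le_mul_of_nonneg_left hxb.le (mul_nonneg hδ.le hAw.le)
    have h6 : δ * (A / w) * (g - x) = δ * P := by rw [hPx]; ring
    have h7 := mul_nonneg (mul_nonneg hδ.le hAw.le) hb
    rw [← hP] at h3
    linarith

theorem Spreading.eventually_gt {ustar : ℝ} {u : ℝ → ℝ → ℝ} {h : ℝ → ℝ}
    (hs : Spreading ustar u h) {A : ℝ} (hA : A < ustar) (K : ℝ) :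
    ∀ᶠ t in atTop, ∀ x ∈ Icc 0 K, A < u t x := by
  have h1 : TendstoLocallyUniformlyOn u (fun _ => ustar) atTop (Icc 0 K) :=
    hs.2.mono Icc_subset_Ici_self
  rw [tendstoLocallyUniformlyOn_iff_tendstoUniformlyOn_of_compact isCompact_Icc,
    Metric.tendstoUniformlyOn_iff] at h1
  filter_upwards [h1 (ustar - A) (by linarith)] with t ht x hx
  have := ht x hx
  rw [Real.dist_eq] at this
  linarith [(abs_lt.1 this).2]

/-! ### Ramps below the solution -/

section

variable {d μ h₀ ustar : ℝ} {J f u₀ : ℝ → ℝ} {u : ℝ → ℝ → ℝ} {h : ℝ → ℝ}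

/-- A ramp whose front `g` moves slowly enough stays below the solution. -/
theorem IsSolution.ramp_le (hd : 0 < d) (hμ : 0 < μ) (hJ : KernelCond J) (hf : GrowthCond f ustar)
    (hu₀ : InitialCond h₀ u₀) (hsol : IsSolution d μ J f h₀ u₀ u h)
    (hspread : Spreading ustar u h) {A σ : ℝ} (hA : 0 < A) (hAu : A < ustar)
    (hσ : σ ∈ Ioc (0 : ℝ) 1) {g g' : ℝ → ℝ}
    (hg : ∀ t, 0 ≤ t → HasDerivAt g (g' t) t) (hg'0 : ∀ t, 0 ≤ t → 0 ≤ g' t)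
    (hg1 : ∀ t, 0 ≤ t → 1 ≤ g t)
    (hE : ∀ t, 0 ≤ t → ∀ x, 0 ≤ x → x < g t → A / (g t ^ σ / 2) * g' t ≤
      d * (∫ y in (0 : ℝ)..(g t), J (x - y) * ramp A (g t) (g t ^ σ / 2) y)
        - d * (∫ y in Ioi (0 : ℝ), J (x - y)) * ramp A (g t) (g t ^ σ / 2) x
        + f (ramp A (g t) (g t ^ σ / 2) x))
    (hF : ∀ t, 0 ≤ t →
      g' t < μ * ∫ x in (0 : ℝ)..(g t), tail J (g t - x) * ramp A (g t) (g t ^ σ / 2) x) :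
    ∃ t₀, ∀ t, t₀ ≤ t →
      g (t - t₀) ≤ h t ∧ ∀ x, 0 ≤ x → x ≤ g (t - t₀) / 2 → A ≤ u t x := by
  have hev := ((hspread.eventually_gt hAu (g 0)).and
    (hspread.1.eventually_gt_atTop (g 0))).and (eventually_ge_atTop 0)
  obtain ⟨t₀, ⟨hu, hh⟩, ht₀⟩ := hev.exists
  have hsub : ∀ {t}, t₀ ≤ t → 0 ≤ t - t₀ := fun ht => sub_nonneg.2 ht
  have hw : ∀ t, 0 ≤ t → 0 < g t ^ σ / 2 := fun t ht => by
    have := Real.rpow_pos_of_pos (one_pos.trans_le (hg1 t ht)) σ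
    linarith
  have hwg : ∀ t, 0 ≤ t → g t ^ σ ≤ g t := fun t ht => by
    simpa using Real.rpow_le_rpow_of_exponent_le (hg1 t ht) hσ.2
  have hmono : MonotoneOn g (Ici 0) := by
    refine monotoneOn_of_deriv_nonneg (convex_Ici 0)
      (fun t ht => (hg t ht).continuousAt.continuousWithinAt) (fun t ht => ?_) fun t ht => ?_
    · rw [interior_Ici] at ht
      exact (hg t (le_of_lt ht)).differentiableAt.differentiableWithinAt
    · rw [interior_Ici] at ht
      rw [(hg t (le_of_lt ht)).deriv]
      exact hg'0 t (le_of_lt ht)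
  have hshift : ∀ t, t₀ ≤ t → HasDerivAt (fun t => g (t - t₀)) (g' (t - t₀)) t := fun t ht =>
    (hg (t - t₀) (hsub ht)).comp_sub_const t t₀
  refine ⟨t₀, fun t ht => ?_⟩
  have hmain := hsol.lower_solution hd hμ hJ hf hu₀ (t₀ := t₀) (B := A)
    (v := fun t x => ramp A (g (t - t₀)) (g (t - t₀) ^ σ / 2) x)
    (g := fun t => g (t - t₀)) (g' := fun t => g' (t - t₀)) ht₀ hshift ?_
    (fun s hs => zero_le_one.trans (hg1 _ (hsub hs))) (fun _ _ => NonlocalFB.ramp_le hA.le)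
    (fun s hs => ramp_eq_zero (hw _ (hsub hs)) le_rfl) (by simpa using hh)
    (fun x hx hx' => by
      simp only [sub_self] at hx' ⊢
      exact (NonlocalFB.ramp_le hA.le).trans (hu x ⟨hx, hx'⟩).le)
    ?_ (fun s hs => hF _ (hsub hs.le)) ht
  · refine ⟨hmain.1, fun x hx hx' => ?_⟩
    have h1 := hg1 _ (hsub ht)
    have h2 := hmain.2 x hx (by linarith)
    rwa [ramp_eq_of_le (hw _ (hsub ht)) (by linarith [hwg _ (hsub ht)])] at h2
  · have hgc : ContinuousOn (fun p : ℝ × ℝ => g (p.1 - t₀))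
        {p | t₀ ≤ p.1 ∧ 0 ≤ p.2 ∧ p.2 ≤ g (p.1 - t₀)} := fun p hp =>
      ((hshift p.1 hp.1).continuousAt.comp continuousAt_fst).continuousWithinAt
    have hpos : ∀ p ∈ {p : ℝ × ℝ | t₀ ≤ p.1 ∧ 0 ≤ p.2 ∧ p.2 ≤ g (p.1 - t₀)},
        1 ≤ g (p.1 - t₀) := fun p hp => hg1 _ (hsub hp.1)
    unfold ramp
    refine continuousOn_const.mul (continuousOn_const.sup (continuousOn_const.inf
      ((hgc.sub continuousOn_snd).div ((hgc.rpow_const fun p hp => Or.inl ?_).div_const 2)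
        fun p hp => ?_)))
    · exact (one_pos.trans_le (hpos p hp)).ne'
    · exact (hw _ (hsub hp.1)).ne'
  · intro s hs x hx hxg
    have hs' := hsub hs.le
    have hwpos := hw _ hs'
    have hEs := hE (s - t₀) hs' x hx hxg
    have hgs : 0 < g (s - t₀) := one_pos.trans_le (hg1 _ hs')
    -- Strictly inside the plateau the ramp is locally constant in time. The kink `= 1` belongs to
    -- the sloped case: the quotient increases with time, so at earlier times the cap at `1` is
    -- inactive and the linear expression touches from below.
    rcases lt_or_ge 1 ((g (s - t₀) - x) / (g (s - t₀) ^ σ / 2)) with hq | hq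
    · refine ⟨fun _ => A, 0, hasDerivAt_const s A, ?_, ?_, ?_⟩
      · rw [ramp_eq_of_le hwpos]
        rw [lt_div_iff₀ hwpos] at hq
        linarith
      · have hc : ContinuousAt (fun r => (g (r - t₀) - x) / (g (r - t₀) ^ σ / 2)) s := by
          have := (hshift s hs.le).continuousAt
          exact (this.sub continuousAt_const).div
            ((this.rpow_const (Or.inl hgs.ne')).div_const 2) hwpos.ne'
        have := nhdsWithin_le_nhds (s := Iio s) (hc.eventually (lt_mem_nhds hq))
        filter_upwards [this] with r hr
        have hr' : (1 : ℝ) < (g (r - t₀) - x) / (g (r - t₀) ^ σ / 2) := hr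
        simp [ramp, hr'.le]
      · exact (mul_nonneg (div_nonneg hA.le hwpos.le) (hg'0 _ hs')).trans hEs
    · have hds := hshift s hs.le
      have hdφ := (((hds.sub_const x).mul
        (hds.rpow_const (p := -σ) (Or.inl hgs.ne'))).const_mul (2 * A))
      have hinv : ∀ r, t₀ ≤ r → g (r - t₀) ^ (-σ) = (g (r - t₀) ^ σ)⁻¹ := fun r hr =>
        Real.rpow_neg (zero_le_one.trans (hg1 _ (hsub hr))) σ
      have hlin : ∀ r, t₀ ≤ r → 2 * A * ((g (r - t₀) - x) * g (r - t₀) ^ (-σ)) =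
          A * ((g (r - t₀) - x) / (g (r - t₀) ^ σ / 2)) := fun r hr => by
        rw [hinv r hr]
        have := (Real.rpow_pos_of_pos (one_pos.trans_le (hg1 _ (hsub hr))) σ).ne'
        field_simp
      refine ⟨_, _, hdφ, ?_, ?_, ?_⟩
      · simp only [Pi.mul_apply]
        rw [hlin s hs.le, ramp, min_eq_right hq, max_eq_right]
        exact div_nonneg (by linarith) hwpos.le
      · rw [← nhdsWithin_Ioo_eq_nhdsLT hs]
        filter_upwards [self_mem_nhdsWithin] with r hr
        simp only [Pi.mul_apply]
        rw [hlin r hr.1.le, ramp]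
        refine mul_le_mul_of_nonneg_left ?_ hA.le
        have hr' := hsub hr.1.le
        have hgr : 0 < g (r - t₀) := one_pos.trans_le (hg1 _ hr')
        have hle : g (r - t₀) ≤ g (s - t₀) := hmono hr' hs' (by linarith [hr.2])
        have hqr : (g (r - t₀) - x) / (g (r - t₀) ^ σ / 2) ≤
            (g (s - t₀) - x) / (g (s - t₀) ^ σ / 2) := by
          have e : ∀ a : ℝ, 0 < a → (a - x) / (a ^ σ / 2) = 2 * (a ^ (1 - σ) - x * a ^ (-σ)) :=
            fun a ha => by
              rw [Real.rpow_sub ha, Real.rpow_neg ha.le, Real.rpow_one]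
              have := (Real.rpow_pos_of_pos ha σ).ne'
              field_simp
          rw [e _ hgr, e _ hgs]
          have e1 := Real.rpow_le_rpow hgr.le hle (show 0 ≤ 1 - σ by linarith [hσ.2])
          have e2 := mul_le_mul_of_nonneg_left
            (Real.rpow_le_rpow_of_nonpos hgr hle (show -σ ≤ 0 by linarith [hσ.1])) hx
          linarith
        rw [min_eq_right (hqr.trans hq)]
        exact le_max_right _ _
      · refine le_trans ?_ hEs
        have e1 : A / (g (s - t₀) ^ σ / 2) * g' (s - t₀) =
            2 * A * (g' (s - t₀) * g (s - t₀) ^ (-σ)) := by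
          rw [hinv s hs.le]
          have := (Real.rpow_pos_of_pos hgs σ).ne'
          field_simp
        rw [e1]
        refine mul_le_mul_of_nonneg_left ?_ (by linarith)
        -- This is the term from the widening of the ramp; it enters the time derivative negatively
        -- and is dropped.
        have e2 : 0 ≤ (g (s - t₀) - x) * (g' (s - t₀) * σ * g (s - t₀) ^ (-σ - 1)) :=
          mul_nonneg (by linarith) (mul_nonneg (mul_nonneg (hg'0 _ hs') hσ.1.le)
            (Real.rpow_pos_of_pos hgs _).le)
        linarith

/-- Reduction of the lower estimate to growth bounds for the ramp of width `g ^ σ / 2`. -/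
theorem IsSolution.exists_speed (hd : 0 < d) (hμ : 0 < μ) (hJ : KernelCond J)
    (hf : GrowthCond f ustar) (hu₀ : InitialCond h₀ u₀) (hsol : IsSolution d μ J f h₀ u₀ u h)
    (hspread : Spreading ustar u h) {A σ : ℝ} (hA : 0 < A) (hAu : A < ustar)
    (hσ : σ ∈ Ioc (0 : ℝ) 1) {G : ℝ → ℝ} {c : ℝ} (hc : 0 < c)
    (hG : ∀ᶠ g in atTop, (∃ b, 0 ≤ b ∧ b ≤ g ^ σ / 2 / 2 ∧
      c * G g ≤ min (f A / A * b / 2)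
        (d * ∫ z in Icc (2 * b) (g ^ σ / 2 / 2), J z * (z / 2)) / 2) ∧
      c * G g ≤ ∫ z in (g ^ σ / 2)..g, tail J z) :
    ∃ c' H, 0 < c' ∧ ∀ g g' : ℝ → ℝ, (∀ t, 0 ≤ t → HasDerivAt g (g' t) t) →
      (∀ t, 0 ≤ t → 0 ≤ g' t) → (∀ t, 0 ≤ t → H ≤ g t) →
      (∀ t, 0 ≤ t → g' t < c' * G (g t)) →
      ∃ t₀, ∀ t, t₀ ≤ t →
        g (t - t₀) ≤ h t ∧ ∀ x, 0 ≤ x → x ≤ g (t - t₀) / 2 → A ≤ u t x := by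
  obtain ⟨W₀, hW₀, hW⟩ := exists_ramp_width hd hJ hf hA hAu
  have hwt : ∀ᶠ g : ℝ in atTop, W₀ ≤ g ^ σ / 2 :=
    ((tendsto_rpow_atTop hσ.1).atTop_div_const two_pos).eventually_ge_atTop W₀
  obtain ⟨H, hH⟩ := eventually_atTop.1 ((hG.and hwt).and (eventually_ge_atTop 1))
  -- The first entry serves the interior inequality, the second the flux inequality.
  refine ⟨min c (μ * A * c), H, lt_min hc (by positivity), fun g g' hg hg'0 hgH hg' => ?_⟩
  have hG0 : ∀ t, 0 ≤ t → 0 < G (g t) := fun t ht =>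
    pos_of_mul_pos_right ((hg'0 t ht).trans_lt (hg' t ht)) (le_min hc.le (by positivity))
  refine hsol.ramp_le hd hμ hJ hf hu₀ hspread hA hAu hσ hg hg'0
    (fun t ht => (hH _ (hgH t ht)).2) (fun t ht x hx hxg => ?_) fun t ht => ?_
  · obtain ⟨⟨⟨⟨b, hb0, hb1, hb⟩, -⟩, hw⟩, h1⟩ := hH _ (hgH t ht)
    have hwg : g t ^ σ ≤ g t := by
      simpa using Real.rpow_le_rpow_of_exponent_le h1 hσ.2
    have := hW _ hw (g t) (by linarith) b hb0 hb1 x hx hxg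
    refine le_trans ?_ this
    rw [mul_div_assoc]
    refine mul_le_mul_of_nonneg_left ?_ (div_nonneg hA.le (hW₀.le.trans hw))
    refine le_trans ?_ hb
    exact (hg' t ht).le.trans (mul_le_mul_of_nonneg_right (min_le_left _ _) (hG0 t ht).le)
  · obtain ⟨⟨⟨-, hb⟩, hw⟩, h1⟩ := hH _ (hgH t ht)
    have hwg : g t ^ σ ≤ g t := by
      simpa using Real.rpow_le_rpow_of_exponent_le h1 hσ.2
    have hw0 := hW₀.trans_le hw
    have h2 := hJ.flux_ramp_ge (g := g t) hA.le hw0 (by linarith)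
    refine (hg' t ht).trans_le ?_
    refine (mul_le_mul_of_nonneg_right (min_le_right _ _) (hG0 t ht).le).trans ?_
    refine le_trans ?_ (mul_le_mul_of_nonneg_left h2 hμ.le)
    have := mul_le_mul_of_nonneg_left hb (mul_nonneg hμ.le hA.le)
    linarith

end

/-! ### Power tails: gains of the ramp and size of the tail integral -/

section

variable {J : ℝ → ℝ} {γ c₁ c₂ R : ℝ}

/-- The mass on `[z, 2z]` alone has the right order. -/
theorem KernelCond.tail_ge (hJ : KernelCond J) (hγ : 0 ≤ γ) (hc₁ : 0 ≤ c₁) (hR : 0 < R)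
    (hlow : ∀ x, R ≤ |x| → c₁ * |x| ^ (-γ) ≤ J x) {z : ℝ} (hz : R ≤ z) :
    c₁ * 2 ^ (-γ) * z ^ (1 - γ) ≤ tail J z := by
  have hz0 : 0 < z := hR.trans_le hz
  have h1 : ∫ _ in z..(2 * z), c₁ * (2 * z) ^ (-γ) ≤ ∫ y in z..(2 * z), J y := by
    refine intervalIntegral.integral_mono_on (by linarith) (by simp)
      (hJ.continuous.intervalIntegrable _ _) fun y hy => ?_
    have hy0 : 0 < y := hz0.trans_le hy.1
    refine le_trans ?_ (hlow y (by rw [abs_of_pos hy0]; exact hz.trans hy.1))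
    rw [abs_of_pos hy0]
    exact mul_le_mul_of_nonneg_left
      (Real.rpow_le_rpow_of_nonpos hy0 hy.2 (by linarith)) hc₁
  rw [← hJ.tail_sub_tail, intervalIntegral.integral_const, smul_eq_mul] at h1
  have h2 := hJ.tail_nonneg (2 * z)
  have h3 : c₁ * 2 ^ (-γ) * z ^ (1 - γ) = (2 * z - z) * (c₁ * (2 * z) ^ (-γ)) := by
    rw [Real.mul_rpow two_pos.le hz0.le, sub_eq_add_neg, Real.rpow_add hz0, Real.rpow_one]
    ring
  linarith

theorem KernelCond.exists_tail_le (hJ : KernelCond J) (hγ : 1 < γ) (hR : 0 < R)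
    (hup : ∀ x, R ≤ |x| → J x ≤ c₂ * |x| ^ (-γ)) :
    ∃ C, 0 < C ∧ ∀ z, 0 < z → tail J z ≤ C * z ^ (1 - γ) := by
  have hfar : ∀ z, R ≤ z → tail J z ≤ c₂ / (γ - 1) * z ^ (1 - γ) := fun z hz => by
    have hz0 : 0 < z := hR.trans_le hz
    have h1 : tail J z ≤ ∫ y in Ioi z, c₂ * y ^ (-γ) := by
      refine setIntegral_mono_on hJ.integrable.integrableOn
        ((integrableOn_Ioi_rpow_of_lt (by linarith) hz0).const_mul _) measurableSet_Ioi
        fun y hy => ?_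
      have hy' : z < y := hy
      have := hup y (by rw [abs_of_pos (hz0.trans hy')]; exact hz.trans hy'.le)
      rwa [abs_of_pos (hz0.trans hy')] at this
    rw [integral_const_mul, integral_Ioi_rpow_of_lt (by linarith) hz0] at h1
    refine h1.trans_eq ?_
    have e : -γ + 1 = 1 - γ := by ring
    have h2 : γ - 1 ≠ 0 := by linarith
    have h3 : 1 - γ ≠ 0 := by linarith
    rw [e]
    field_simp
    ring
  -- The second constant covers `z < R`, where `tail J ≤ 1` is all that is used.
  refine ⟨max (c₂ / (γ - 1)) (R ^ (γ - 1)), lt_max_of_lt_right (Real.rpow_pos_of_pos hR _),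
    fun z hz => ?_⟩
  have hzp := Real.rpow_pos_of_pos hz (1 - γ)
  rcases le_total R z with h | h
  · exact (hfar z h).trans (mul_le_mul_of_nonneg_right (le_max_left _ _) hzp.le)
  · refine (hJ.tail_le_one z).trans (le_trans ?_
      (mul_le_mul_of_nonneg_right (le_max_right _ _) hzp.le))
    calc (1 : ℝ) = R ^ (γ - 1) * R ^ (1 - γ) := by
          rw [← Real.rpow_add hR]; simp
      _ ≤ _ := mul_le_mul_of_nonneg_left
          (Real.rpow_le_rpow_of_nonpos hz h (by linarith)) (Real.rpow_pos_of_pos hR _).le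

/-- With width `g/2` and `b = g/16`, the foot integral of `z^(1-γ)` over `[g/8, g/4]` and the flux
integral over `[g/2, g]` are both of order `g^(2-γ)`; the reaction gain is of order `g`, which is
larger. -/
theorem KernelCond.exists_gain_of_lt_two (hJ : KernelCond J) (hγ : γ ∈ Ioo (1 : ℝ) 2)
    (hc₁ : 0 < c₁) (hR : 0 < R) (hlow : ∀ x, R ≤ |x| → c₁ * |x| ^ (-γ) ≤ J x) {δ d : ℝ}
    (hδ : 0 < δ) (hd : 0 < d) :
    ∃ c, 0 < c ∧ ∀ᶠ g : ℝ in atTop, (∃ b, 0 ≤ b ∧ b ≤ g ^ (1 : ℝ) / 2 / 2 ∧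
      c * g ^ (2 - γ) ≤ min (δ * b / 2)
        (d * ∫ z in Icc (2 * b) (g ^ (1 : ℝ) / 2 / 2), J z * (z / 2)) / 2) ∧
      c * g ^ (2 - γ) ≤ ∫ z in (g ^ (1 : ℝ) / 2)..g, tail J z := by
  have hγ0 : 0 ≤ γ := by linarith [hγ.1]
  set k₁ := δ / 64
  set k₂ := d * c₁ / 256
  set k₃ := c₁ * 2 ^ (-γ) / 2
  have hk₁ : 0 < k₁ := by positivity
  have hk₂ : 0 < k₂ := by positivity
  have hk₃ : 0 < k₃ := by positivity
  refine ⟨min k₁ (min k₂ k₃), lt_min hk₁ (lt_min hk₂ hk₃), ?_⟩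
  filter_upwards [eventually_ge_atTop 1, eventually_ge_atTop (8 * R)] with g hg1 hgR
  have hg0 : 0 < g := one_pos.trans_le hg1
  have hGp := Real.rpow_pos_of_pos hg0 (2 - γ)
  have e₁ : min k₁ (min k₂ k₃) * g ^ (2 - γ) ≤ k₁ * g ^ (2 - γ) :=
    mul_le_mul_of_nonneg_right (min_le_left _ _) hGp.le
  have e₂ : min k₁ (min k₂ k₃) * g ^ (2 - γ) ≤ k₂ * g ^ (2 - γ) :=
    mul_le_mul_of_nonneg_right ((min_le_right _ _).trans (min_le_left _ _)) hGp.le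
  have e₃ : min k₁ (min k₂ k₃) * g ^ (2 - γ) ≤ k₃ * g ^ (2 - γ) :=
    mul_le_mul_of_nonneg_right ((min_le_right _ _).trans (min_le_right _ _)) hGp.le
  have hsq : g ^ (2 - γ) = g * g * g ^ (-γ) := by
    rw [sub_eq_add_neg, Real.rpow_add hg0, Real.rpow_two]; ring
  rw [Real.rpow_one]
  refine ⟨⟨g / 16, by positivity, by linarith, ?_⟩, e₃.trans ?_⟩
  · rw [le_div_iff₀ two_pos]
    refine le_min ?_ ?_
    · have : g ^ (2 - γ) ≤ g := by
        simpa using Real.rpow_le_rpow_of_exponent_le hg1 (show 2 - γ ≤ 1 by linarith [hγ.1])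
      have h2 := mul_le_mul_of_nonneg_left this hk₁.le
      have h3 : k₁ * g = δ * (g / 16) / 2 / 2 := by simp only [k₁]; ring
      linarith
    · have hb : ∫ _ in Icc (2 * (g / 16)) (g / 2 / 2), c₁ * g ^ (-γ) * (g / 16) ≤
          ∫ z in Icc (2 * (g / 16)) (g / 2 / 2), J z * (z / 2) := by
        refine setIntegral_mono_on continuousOn_const.integrableOn_Icc ?_ measurableSet_Icc
          fun z hz => ?_
        · exact (hJ.continuous.mul (by fun_prop)).continuousOn.integrableOn_Icc
        · have hz0 : 0 < z := by linarith [hz.1]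
          have h1 := hlow z (by rw [abs_of_pos hz0]; linarith [hz.1])
          rw [abs_of_pos hz0] at h1
          have h2 := Real.rpow_le_rpow_of_nonpos hz0 (show z ≤ g by linarith [hz.2])
            (show -γ ≤ 0 by linarith)
          exact mul_le_mul ((mul_le_mul_of_nonneg_left h2 hc₁.le).trans h1)
            (by linarith [hz.1]) (by positivity) (hJ.nonneg _)
      rw [setIntegral_const, smul_eq_mul, Measure.real, Real.volume_Icc,
        ENNReal.toReal_ofReal (by linarith)] at hb
      have h2 := mul_le_mul_of_nonneg_left hb hd.le
      have h3 : k₂ * g ^ (2 - γ) * 2 =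
          d * ((g / 2 / 2 - 2 * (g / 16)) * (c₁ * g ^ (-γ) * (g / 16))) := by
        rw [hsq]; simp only [k₂]; ring
      linarith
  · have hb : ∫ _ in (g / 2)..g, c₁ * 2 ^ (-γ) * g ^ (1 - γ) ≤ ∫ z in (g / 2)..g, tail J z := by
      refine intervalIntegral.integral_mono_on (by linarith) (by simp)
        (hJ.continuous_tail.intervalIntegrable _ _) fun z hz => ?_
      exact (hJ.tail_ge hγ0 hc₁.le hR hlow (by linarith)).trans (hJ.tail_antitone hz.2)
    rw [intervalIntegral.integral_const, smul_eq_mul] at hb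
    refine le_trans (le_of_eq ?_) hb
    have : g ^ (1 - γ) = g * g ^ (-γ) := by
      rw [sub_eq_add_neg, Real.rpow_add hg0, Real.rpow_one]
    rw [hsq, this]; simp only [k₃]; ring

/-- A width proportional to `g` would leave integrals of `1/z` over intervals of bounded ratio and
no logarithm. With width `√g / 2` and `q = g^(1/4) = 2b`, the foot interval `[q, q²/4]` and the flux
interval `[q²/2, q⁴]` both yield multiples of `log g`, while the reaction gain is of order `q`. -/
theorem KernelCond.exists_gain_two (hJ : KernelCond J)
    (hc₁ : 0 < c₁) (hR : 0 < R) (hlow : ∀ x, R ≤ |x| → c₁ * |x| ^ (-2 : ℝ) ≤ J x) {δ d : ℝ}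
    (hδ : 0 < δ) (hd : 0 < d) :
    ∃ c, 0 < c ∧ ∀ᶠ g : ℝ in atTop, (∃ b, 0 ≤ b ∧ b ≤ g ^ (1 / 2 : ℝ) / 2 / 2 ∧
      c * Real.log g ≤ min (δ * b / 2)
        (d * ∫ z in Icc (2 * b) (g ^ (1 / 2 : ℝ) / 2 / 2), J z * (z / 2)) / 2) ∧
      c * Real.log g ≤ ∫ z in (g ^ (1 / 2 : ℝ) / 2)..g, tail J z := by
  set k₁ := δ / 64
  set k₂ := d * c₁ / 64
  set k₃ := c₁ * 2 ^ (-2 : ℝ) / 2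
  have hk₁ : 0 < k₁ := by positivity
  have hk₂ : 0 < k₂ := by positivity
  have hk₃ : 0 < k₃ := by positivity
  refine ⟨min k₁ (min k₂ k₃), lt_min hk₁ (lt_min hk₂ hk₃), ?_⟩
  have hpow : ∀ a : ℝ, 0 < a → Tendsto (fun g : ℝ => g ^ a) atTop atTop := fun a ha =>
    tendsto_rpow_atTop ha
  filter_upwards [eventually_gt_atTop 1, eventually_ge_atTop (4 * R * R),
    (hpow (1 / 4) (by norm_num)).eventually_ge_atTop R,
    (hpow (1 / 8) (by norm_num)).eventually_ge_atTop 4] with g hg1 hgR hgR4 hg8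
  have hg0 : 0 < g := one_pos.trans hg1
  have hL : 0 < Real.log g := Real.log_pos hg1
  have e₁ : min k₁ (min k₂ k₃) * Real.log g ≤ k₁ * Real.log g :=
    mul_le_mul_of_nonneg_right (min_le_left _ _) hL.le
  have e₂ : min k₁ (min k₂ k₃) * Real.log g ≤ k₂ * Real.log g :=
    mul_le_mul_of_nonneg_right ((min_le_right _ _).trans (min_le_left _ _)) hL.le
  have e₃ : min k₁ (min k₂ k₃) * Real.log g ≤ k₃ * Real.log g :=
    mul_le_mul_of_nonneg_right ((min_le_right _ _).trans (min_le_right _ _)) hL.le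
  set q := g ^ (1 / 4 : ℝ) with hq
  have hq0 : 0 < q := Real.rpow_pos_of_pos hg0 _
  have hhalf : g ^ (1 / 2 : ℝ) = q * q := by
    rw [hq, ← Real.rpow_add hg0]; norm_num
  have hgq : g = q * q * (q * q) := by
    rw [← hhalf, ← Real.rpow_add hg0]; norm_num
  have h8 : q = g ^ (1 / 8 : ℝ) * g ^ (1 / 8 : ℝ) := by
    rw [hq, ← Real.rpow_add hg0]; norm_num
  have hq16 : 16 ≤ q := by
    rw [h8]; nlinarith
  have hlogq : Real.log q = Real.log g / 4 := by
    rw [hq, Real.log_rpow hg0]; ring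
  have hlogq4 : Real.log g / 8 ≤ Real.log (q / 4) := by
    have h1 : Real.log 4 ≤ Real.log (g ^ (1 / 8 : ℝ)) := Real.log_le_log (by norm_num) hg8
    rw [Real.log_rpow hg0] at h1
    rw [Real.log_div hq0.ne' (by norm_num), hlogq]
    linarith
  rw [hhalf]
  have hsub : q ≤ q * q / 2 / 2 := by nlinarith
  refine ⟨⟨q / 2, by positivity, by linarith, ?_⟩, e₃.trans ?_⟩
  · rw [le_div_iff₀ two_pos]
    refine le_min ?_ ?_
    · have h1 : Real.log g ≤ 4 * q := by
        have := Real.log_le_sub_one_of_pos hq0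
        linarith
      have h2 := mul_le_mul_of_nonneg_left h1 hk₁.le
      have h3 : k₁ * (4 * q) * 2 = δ * (q / 2) / 2 / 2 := by simp only [k₁]; ring
      have h4 : 0 < δ * (q / 2) / 2 := by positivity
      linarith
    · rw [show 2 * (q / 2) = q by ring, integral_Icc_eq_integral_Ioc,
        ← intervalIntegral.integral_of_le hsub]
      have hb : ∫ z in q..(q * q / 2 / 2), c₁ / 2 * z⁻¹ ≤
          ∫ z in q..(q * q / 2 / 2), J z * (z / 2) := by
        refine intervalIntegral.integral_mono_on hsub ?_ ?_ fun z hz => ?_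
        · refine (intervalIntegral.intervalIntegrable_inv (fun z hz => ?_)
            continuousOn_id).const_mul _
          rw [uIcc_of_le hsub] at hz
          exact (hq0.trans_le hz.1).ne'
        · exact (hJ.continuous.mul (by fun_prop)).intervalIntegrable _ _
        · have hz0 : 0 < z := hq0.trans_le hz.1
          have h1 := hlow z (by rw [abs_of_pos hz0]; linarith [hz.1])
          rw [abs_of_pos hz0] at h1
          refine le_trans (le_of_eq ?_) (mul_le_mul_of_nonneg_right h1 (by positivity))
          rw [Real.rpow_neg hz0.le, Real.rpow_two]
          field_simp
      rw [intervalIntegral.integral_const_mul, integral_inv_of_pos hq0 (by positivity),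
        show q * q / 2 / 2 / q = q / 4 by field_simp; norm_num] at hb
      have h2 := mul_le_mul_of_nonneg_left hb hd.le
      have h3 := mul_le_mul_of_nonneg_left hlogq4 (show 0 ≤ d * (c₁ / 2) by positivity)
      have h4 : k₂ * Real.log g * 2 = d * (c₁ / 2) * (Real.log g / 8) / 2 := by
        simp only [k₂]; ring
      have h5 : 0 < d * (c₁ / 2) * (Real.log g / 8) := by positivity
      linarith
  · have hwg : q * q / 2 ≤ g := by rw [hgq]; nlinarith
    have hw0 : 0 < q * q / 2 := by positivity
    have hwR : R ≤ q * q / 2 := by nlinarith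
    have hb : ∫ z in (q * q / 2)..g, c₁ * 2 ^ (-2 : ℝ) * z⁻¹ ≤
        ∫ z in (q * q / 2)..g, tail J z := by
      refine intervalIntegral.integral_mono_on hwg ?_
        (hJ.continuous_tail.intervalIntegrable _ _) fun z hz => ?_
      · refine (intervalIntegral.intervalIntegrable_inv (fun z hz => ?_)
          continuousOn_id).const_mul _
        rw [uIcc_of_le hwg] at hz
        exact (hw0.trans_le hz.1).ne'
      · have := hJ.tail_ge (by norm_num) hc₁.le hR hlow (hwR.trans hz.1)
        rwa [show (1 - 2 : ℝ) = -1 by norm_num, Real.rpow_neg_one] at this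
    rw [intervalIntegral.integral_const_mul, integral_inv_of_pos hw0 hg0] at hb
    refine le_trans ?_ hb
    have h1 : Real.log g / 2 ≤ Real.log (g / (q * q / 2)) := by
      have h2 : Real.log (q * q) = Real.log g / 2 := by
        rw [Real.log_mul hq0.ne' hq0.ne', hlogq]; ring
      rw [← h2]
      refine Real.log_le_log (by positivity) ?_
      rw [le_div_iff₀ hw0, hgq]
      nlinarith [mul_pos (mul_pos hq0 hq0) (mul_pos hq0 hq0)]
    have := mul_le_mul_of_nonneg_left h1 (show 0 ≤ c₁ * 2 ^ (-2 : ℝ) by positivity)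
    simp only [k₃]
    linarith

theorem KernelCond.exists_integral_tail_le_of_lt_two (hJ : KernelCond J)
    (hγ : γ ∈ Ioo (1 : ℝ) 2) (hR : 0 < R) (hup : ∀ x, R ≤ |x| → J x ≤ c₂ * |x| ^ (-γ)) :
    ∃ C, 0 < C ∧ ∀ᶠ g : ℝ in atTop, ∫ z in (0 : ℝ)..g, tail J z ≤ C * g ^ (2 - γ) := by
  obtain ⟨C, hC, hT⟩ := hJ.exists_tail_le hγ.1 hR hup
  have h2γ : 0 < 2 - γ := by linarith [hγ.2]
  refine ⟨C / (2 - γ), by positivity, ?_⟩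
  filter_upwards [eventually_ge_atTop 0] with g hg
  have h1 : ∫ z in (0 : ℝ)..g, tail J z ≤ ∫ z in (0 : ℝ)..g, C * z ^ (1 - γ) :=
    intervalIntegral.integral_mono_on_of_le_Ioo hg (hJ.continuous_tail.intervalIntegrable _ _)
      ((intervalIntegral.intervalIntegrable_rpow' (by linarith [hγ.2])).const_mul _)
      fun z hz => hT z hz.1
  refine h1.trans_eq ?_
  rw [intervalIntegral.integral_const_mul, integral_rpow (Or.inl (by linarith)),
    show 1 - γ + 1 = 2 - γ by ring, Real.zero_rpow h2γ.ne']
  ring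

theorem KernelCond.exists_integral_tail_le_two (hJ : KernelCond J) (hR : 0 < R)
    (hup : ∀ x, R ≤ |x| → J x ≤ c₂ * |x| ^ (-2 : ℝ)) :
    ∃ C, 0 < C ∧ ∀ᶠ g : ℝ in atTop, ∫ z in (0 : ℝ)..g, tail J z ≤ C * Real.log g := by
  obtain ⟨C, hC, hT⟩ := hJ.exists_tail_le one_lt_two hR hup
  refine ⟨1 + C, by positivity, ?_⟩
  filter_upwards [eventually_ge_atTop 1, Real.tendsto_log_atTop.eventually_ge_atTop 1]
    with g hg hlog
  have hint : ∀ a b, IntervalIntegrable (tail J) volume a b := fun a b =>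
    hJ.continuous_tail.intervalIntegrable _ _
  -- The majorant `C / z` is not integrable at `0`, hence the split at `1`.
  have h0 : ∫ z in (0 : ℝ)..1, tail J z ≤ ∫ _ in (0 : ℝ)..1, (1 : ℝ) :=
    intervalIntegral.integral_mono_on zero_le_one (hint _ _) (by simp)
      fun z _ => hJ.tail_le_one z
  have h1 : ∫ z in (1 : ℝ)..g, tail J z ≤ ∫ z in (1 : ℝ)..g, C * z⁻¹ := by
    refine intervalIntegral.integral_mono_on hg (hint _ _) ?_ fun z hz => ?_
    · refine (intervalIntegral.intervalIntegrable_inv (fun z hz => ?_)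
        continuousOn_id).const_mul _
      rw [uIcc_of_le hg] at hz
      exact (one_pos.trans_le hz.1).ne'
    · have := hT z (one_pos.trans_le hz.1)
      rwa [show (1 - 2 : ℝ) = -1 by norm_num, Real.rpow_neg_one] at this
  rw [intervalIntegral.integral_const_mul, integral_inv_of_pos one_pos (one_pos.trans_le hg),
    div_one] at h1
  rw [← intervalIntegral.integral_add_adjacent_intervals (hint 0 1) (hint 1 g)]
  simp only [intervalIntegral.integral_const, sub_zero, smul_eq_mul, mul_one] at h0
  linarith

end

/-! ### Integrating the speed inequalities -/

/-- The extra `1` absorbs the constant of integration for large `t`. -/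
theorem eventually_le_of_deriv_le {F F' : ℝ → ℝ} {K : ℝ}
    (hF : ∀ᶠ t in atTop, HasDerivAt F (F' t) t ∧ F' t ≤ K) :
    ∀ᶠ t in atTop, F t ≤ (K + 1) * t := by
  obtain ⟨T, hT⟩ := eventually_atTop.1 hF
  have hanti : AntitoneOn (fun t => F t - K * t) (Ici T) := by
    have hd : ∀ t, T ≤ t → HasDerivAt (fun t => F t - K * t) (F' t - K) t := fun t ht => by
      have h1 : HasDerivAt (fun t => K * t) K t := by
        simpa using (hasDerivAt_id t).const_mul K
      exact (hT t ht).1.sub h1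
    refine antitoneOn_of_deriv_nonpos (convex_Ici T)
      (fun t ht => (hd t ht).continuousAt.continuousWithinAt) (fun t ht => ?_) fun t ht => ?_
    · rw [interior_Ici] at ht
      exact (hd t (le_of_lt ht)).differentiableAt.differentiableWithinAt
    · rw [interior_Ici] at ht
      rw [(hd t (le_of_lt ht)).deriv]
      linarith [(hT t (le_of_lt ht)).2]
  filter_upwards [eventually_ge_atTop T, eventually_ge_atTop (F T - K * T)] with t ht ht'
  have := hanti self_mem_Ici ht ht
  simp only at this
  linarith

section

variable {d μ h₀ ustar γ : ℝ} {J f u₀ : ℝ → ℝ} {u : ℝ → ℝ → ℝ} {h : ℝ → ℝ}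

theorem IsSolution.exists_speed_le (hd : 0 < d) (hμ : 0 < μ) (hJ : KernelCond J)
    (hf : GrowthCond f ustar) (hu₀ : InitialCond h₀ u₀) (hsol : IsSolution d μ J f h₀ u₀ u h)
    (hh : Tendsto h atTop atTop) {G : ℝ → ℝ}
    (hG : ∃ C, 0 < C ∧ ∀ᶠ g : ℝ in atTop, ∫ z in (0 : ℝ)..g, tail J z ≤ C * G g) :
    ∃ (C : ℝ) (h' : ℝ → ℝ), 0 < C ∧
      ∀ᶠ t in atTop, HasDerivAt h (h' t) t ∧ h' t ≤ C * G (h t) := by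
  obtain ⟨C, hC, hG⟩ := hG
  obtain ⟨M, hMu, hM⟩ := hsol.exists_bound hd hJ hf hu₀
  have hM0 : 0 < M := hf.ustar_pos.trans hMu
  refine ⟨μ * M * C,
    fun t => μ * ∫ x in (0 : ℝ)..(h t), ∫ y in Ioi (h t), J (x - y) * u t x, by positivity, ?_⟩
  filter_upwards [hh.eventually hG, eventually_gt_atTop 0, hh.eventually_ge_atTop 0]
    with t htG ht0 hht
  refine ⟨hsol.free_boundary t ht0, ?_⟩
  rw [flux_eq hJ]
  have hTc : ContinuousOn (fun x => tail J (h t - x)) (Icc 0 (h t)) :=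
    (hJ.continuous_tail.comp (by fun_prop)).continuousOn
  have h1 : ∫ x in (0 : ℝ)..(h t), tail J (h t - x) * u t x ≤
      ∫ x in (0 : ℝ)..(h t), tail J (h t - x) * M :=
    intervalIntegral.integral_mono_on hht
      ((hTc.mul (hsol.continuousOn_slice ht0.le)).intervalIntegrable_of_Icc hht)
      ((hTc.mul continuousOn_const).intervalIntegrable_of_Icc hht) fun x hx =>
      mul_le_mul_of_nonneg_left (hM t x ht0.le hx.1 hx.2) (hJ.tail_nonneg _)
  rw [intervalIntegral.integral_mul_const,
    intervalIntegral.integral_comp_sub_left (fun z => tail J z) (h t), sub_self, sub_zero] at h1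
  have h2 := mul_le_mul_of_nonneg_left
    (h1.trans (mul_le_mul_of_nonneg_right htG hM0.le)) hμ.le
  linarith

/-- The power `h^(γ-1)` linearises the inequality: its derivative is at most `C (γ - 1)`. -/
theorem eventually_le_rpow_of_speed_le (hγ : γ ∈ Ioo (1 : ℝ) 2) {C : ℝ} {h' : ℝ → ℝ}
    (hC : 0 < C) (hh : Tendsto h atTop atTop)
    (hh' : ∀ᶠ t in atTop, HasDerivAt h (h' t) t ∧ h' t ≤ C * h t ^ (2 - γ)) :
    ∃ C₂, 0 < C₂ ∧ ∀ᶠ t in atTop, h t ≤ C₂ * t ^ (1 / (γ - 1)) := by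
  have hγ1 : 0 < γ - 1 := by linarith [hγ.1]
  have hF : ∀ᶠ t in atTop, HasDerivAt (fun t => h t ^ (γ - 1))
      (h' t * (γ - 1) * h t ^ (γ - 1 - 1)) t ∧
      h' t * (γ - 1) * h t ^ (γ - 1 - 1) ≤ C * (γ - 1) := by
    filter_upwards [hh', hh.eventually_gt_atTop 0] with t ht ht0
    refine ⟨ht.1.rpow_const (Or.inl ht0.ne'), ?_⟩
    have h1 := mul_le_mul_of_nonneg_right ht.2
      (mul_nonneg hγ1.le (Real.rpow_pos_of_pos ht0 (γ - 1 - 1)).le)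
    have h2 : h t ^ (2 - γ) * h t ^ (γ - 1 - 1) = 1 := by
      rw [← Real.rpow_add ht0, show 2 - γ + (γ - 1 - 1) = 0 by ring, Real.rpow_zero]
    have h3 : C * h t ^ (2 - γ) * ((γ - 1) * h t ^ (γ - 1 - 1)) = C * (γ - 1) := by
      linear_combination C * (γ - 1) * h2
    linarith
  have hK : 0 < C * (γ - 1) + 1 := by positivity
  refine ⟨(C * (γ - 1) + 1) ^ (1 / (γ - 1)), Real.rpow_pos_of_pos hK _, ?_⟩
  filter_upwards [eventually_le_of_deriv_le hF, hh.eventually_gt_atTop 0, eventually_gt_atTop 0]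
    with t ht ht0 ht1
  rw [← Real.mul_rpow hK.le ht1.le]
  have := Real.rpow_le_rpow (Real.rpow_pos_of_pos ht0 _).le ht (show 0 ≤ 1 / (γ - 1) by positivity)
  rwa [← Real.rpow_mul ht0.le, mul_one_div_cancel hγ1.ne', Real.rpow_one] at this

/-- A bootstrap: `log h ≤ 2√h` makes `√h` grow at most linearly, so `h ≤ t³` and `log h ≤ 3 log t`;
then `h' ≤ 3C log t`, which integrates to `t log t`. -/
theorem eventually_le_mul_log_of_speed_le {C : ℝ} {h' : ℝ → ℝ}
    (hC : 0 < C) (hh : Tendsto h atTop atTop)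
    (hh' : ∀ᶠ t in atTop, HasDerivAt h (h' t) t ∧ h' t ≤ C * Real.log (h t)) :
    ∃ C₂, 0 < C₂ ∧ ∀ᶠ t in atTop, h t ≤ C₂ * (t * Real.log t) := by
  have hsqrt : ∀ᶠ t in atTop, HasDerivAt (fun t => √(h t)) (h' t / (2 * √(h t))) t ∧
      h' t / (2 * √(h t)) ≤ C := by
    filter_upwards [hh', hh.eventually_gt_atTop 0] with t ht ht0
    refine ⟨ht.1.sqrt ht0.ne', ?_⟩
    have hs := Real.sqrt_pos.2 ht0
    rw [div_le_iff₀ (by positivity)]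
    have h1 : Real.log (h t) = 2 * Real.log √(h t) := by
      rw [Real.log_sqrt ht0.le]; ring
    have h2 := Real.log_le_sub_one_of_pos hs
    have h3 := mul_le_mul_of_nonneg_left (show Real.log (h t) ≤ 2 * √(h t) by linarith) hC.le
    linarith [ht.2]
  have hlog : ∀ᶠ t in atTop, Real.log (h t) ≤ 3 * Real.log t := by
    filter_upwards [eventually_le_of_deriv_le hsqrt, hh.eventually_gt_atTop 0,
      eventually_gt_atTop 0, eventually_ge_atTop ((C + 1) ^ 2)] with t ht ht0 ht1 ht2
    have h1 : h t ≤ ((C + 1) * t) ^ 2 := by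
      rw [← Real.sq_sqrt ht0.le]
      exact pow_le_pow_left₀ (Real.sqrt_nonneg _) ht 2
    have h2 : h t ≤ t ^ 3 := h1.trans (by nlinarith [sq_nonneg t])
    have := Real.log_le_log ht0 h2
    rwa [Real.log_pow] at this
  have hF : ∀ᶠ t in atTop, HasDerivAt (fun t => h t - 3 * C * (t * Real.log t))
      (h' t - 3 * C * (1 * Real.log t + t * t⁻¹)) t ∧
      h' t - 3 * C * (1 * Real.log t + t * t⁻¹) ≤ 0 := by
    filter_upwards [hh', hlog, eventually_gt_atTop 0] with t ht htl ht0
    refine ⟨ht.1.sub (((hasDerivAt_id t).mul (Real.hasDerivAt_log ht0.ne')).const_mul _), ?_⟩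
    rw [mul_inv_cancel₀ ht0.ne']
    have := mul_le_mul_of_nonneg_left htl hC.le
    linarith [ht.2]
  refine ⟨3 * C + 1, by positivity, ?_⟩
  filter_upwards [eventually_le_of_deriv_le hF, eventually_ge_atTop 0,
    Real.tendsto_log_atTop.eventually_ge_atTop 1] with t ht ht0 ht1
  nlinarith

/-- From lower bounds at every height below `ustar` and an upper bound for the front to the
asymptotic statements. -/
theorem IsSolution.comparable_and_converges (hd : 0 < d) (hJ : KernelCond J)
    (hf : GrowthCond f ustar) (hu₀ : InitialCond h₀ u₀) (hsol : IsSolution d μ J f h₀ u₀ u h)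
    {φ : ℝ → ℝ} (hφ : ∀ᶠ t in atTop, 0 < φ t)
    (hlow : ∀ A, 0 < A → A < ustar → ∃ c, 0 < c ∧ ∀ᶠ t in atTop,
      c * φ t ≤ h t ∧ ∀ x, 0 ≤ x → x ≤ c * φ t → A ≤ u t x)
    (hup : ∃ C, 0 < C ∧ ∀ᶠ t in atTop, h t ≤ C * φ t) :
    Comparable h φ ∧ ∀ s : ℝ → ℝ, (∀ᶠ t in atTop, 0 ≤ s t) → s =o[atTop] φ →
      ConvergesUpTo ustar u h s := by
  have hu := hf.ustar_pos
  have hs_le : ∀ {s : ℝ → ℝ}, s =o[atTop] φ → ∀ {c : ℝ}, 0 < c → ∀ᶠ t in atTop, s t ≤ c * φ t := by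
    intro s hs c hc
    filter_upwards [hs.bound hc, hφ] with t ht htφ
    rw [Real.norm_of_nonneg htφ.le] at ht
    exact (le_abs_self _).trans ht
  constructor
  · obtain ⟨c, hc, hcl⟩ := hlow (ustar / 2) (by linarith) (by linarith)
    obtain ⟨C, hC, hCu⟩ := hup
    exact ⟨c, C, hc, hC, by filter_upwards [hcl, hCu] with t h1 h2 using ⟨h1.1, h2⟩⟩
  · intro s _ hs
    constructor
    · obtain ⟨c, hc, hcl⟩ := hlow (ustar / 2) (by linarith) (by linarith)
      filter_upwards [hcl, hs_le hs hc] with t h1 h2 using h2.trans h1.1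
    · intro ε hε
      -- The minimum with `ustar` keeps the height `A = ustar - η` positive.
      have hη : 0 < min ε ustar / 2 := half_pos (lt_min hε hu)
      have hη1 : min ε ustar ≤ ε := min_le_left _ _
      have hη2 : min ε ustar ≤ ustar := min_le_right _ _
      obtain ⟨c, hc, hcl⟩ := hlow (ustar - min ε ustar / 2) (by linarith) (by linarith)
      filter_upwards [hcl, hs_le hs hc, hsol.eventually_le hd hJ hf hu₀ hη] with t h1 h2 h3 x hx
      have h4 := h1.2 x hx.1 (hx.2.trans h2)
      have h5 := h3 x hx.1 (hx.2.trans (h2.trans h1.1))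
      rw [abs_lt]
      constructor <;> linarith

theorem IsSolution.lower_of_lt_two (hd : 0 < d) (hμ : 0 < μ) (hJ : KernelCond J)
    (hJγ : PowerTail γ J) (hf : GrowthCond f ustar) (hu₀ : InitialCond h₀ u₀)
    (hsol : IsSolution d μ J f h₀ u₀ u h) (hspread : Spreading ustar u h)
    (hγ : γ ∈ Ioo (1 : ℝ) 2) {A : ℝ} (hA : 0 < A) (hAu : A < ustar) :
    ∃ c, 0 < c ∧ ∀ᶠ t in atTop, c * t ^ (1 / (γ - 1)) ≤ h t ∧
      ∀ x, 0 ≤ x → x ≤ c * t ^ (1 / (γ - 1)) → A ≤ u t x := by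
  obtain ⟨c₁, c₂, R, hc₁, -, hR, hJR⟩ := hJγ
  obtain ⟨c, hc, hgain⟩ := hJ.exists_gain_of_lt_two hγ hc₁ hR (fun x hx => (hJR x hx).1)
    (div_pos (hf.pos_of_lt hA hAu) hA) hd
  obtain ⟨c', H, hc', hspeed⟩ := hsol.exists_speed hd hμ hJ hf hu₀ hspread hA hAu
    ⟨one_pos, le_rfl⟩ (G := fun g => g ^ (2 - γ)) hc hgain
  have hγ1 : 0 < γ - 1 := by linarith [hγ.1]
  set p := 1 / (γ - 1) with hp
  have hp1 : 1 ≤ p := by rw [hp, le_div_iff₀ hγ1]; linarith [hγ.2]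
  have hpp : p * (2 - γ) = p - 1 := by rw [hp]; field_simp; ring
  -- The front is `g = (k t + θ)^p`. Since `p (2 - γ) = p - 1`, `g' = k p g^(2-γ)`, and `k p = c'/2`
  -- makes the speed bound strict.
  set k := c' / (2 * p) with hk
  have hk0 : 0 < k := by positivity
  set θ := max H 1
  have hθ1 : 1 ≤ θ := le_max_right _ _
  have hbase : ∀ t, 0 ≤ t → θ ≤ k * t + θ := fun t ht => by
    have := mul_nonneg hk0.le ht
    linarith
  refine (hspeed (fun t => (k * t + θ) ^ p) (fun t => k * p * (k * t + θ) ^ (p - 1))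
    (fun t ht => ?_) (fun t ht => ?_) (fun t ht => ?_) (fun t ht => ?_)).elim fun t₀ ht₀ => ?_
  · have h1 : HasDerivAt (fun t : ℝ => k * t + θ) k t := by
      simpa using ((hasDerivAt_id t).const_mul k).add_const θ
    exact h1.rpow_const (Or.inr hp1)
  · have := Real.rpow_nonneg (zero_le_one.trans (hθ1.trans (hbase t ht))) (p - 1)
    positivity
  · have h1 := hθ1.trans (hbase t ht)
    have h2 := Real.rpow_le_rpow_of_exponent_le h1 hp1
    rw [Real.rpow_one] at h2
    exact (le_max_left _ _).trans ((hbase t ht).trans h2)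
  · have h1 : 0 < k * t + θ := one_pos.trans_le (hθ1.trans (hbase t ht))
    rw [← Real.rpow_mul h1.le, hpp]
    refine mul_lt_mul_of_pos_right ?_ (Real.rpow_pos_of_pos h1 _)
    have : k * p = c' / 2 := by rw [hk]; field_simp
    linarith
  · have hq : 0 < (k / 2) ^ p := Real.rpow_pos_of_pos (by positivity) _
    -- Inside the power, `k / 2` pays for the time shift `t - t₀ ≥ t / 2`; the outer half is because
    -- `u ≥ A` is known only on half of `[0, g]`.
    refine ⟨(k / 2) ^ p / 2, by positivity, ?_⟩
    filter_upwards [eventually_ge_atTop t₀, eventually_ge_atTop (2 * t₀), eventually_ge_atTop 0]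
      with t h1 h2 h3
    have hle : (k / 2) ^ p * t ^ p ≤ (k * (t - t₀) + θ) ^ p := by
      rw [← Real.mul_rpow (by positivity) h3]
      refine Real.rpow_le_rpow (by positivity) ?_ (by linarith)
      have := mul_le_mul_of_nonneg_left (show t / 2 ≤ t - t₀ by linarith) hk0.le
      linarith
    have htp : 0 ≤ t ^ p := Real.rpow_nonneg h3 p
    have hqt := mul_nonneg hq.le htp
    obtain ⟨h4, h5⟩ := ht₀ t h1
    refine ⟨?_, fun x hx hx' => h5 x hx ?_⟩
    · linarith
    · linarith

theorem IsSolution.lower_two (hd : 0 < d) (hμ : 0 < μ) (hJ : KernelCond J)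
    (hJγ : PowerTail 2 J) (hf : GrowthCond f ustar) (hu₀ : InitialCond h₀ u₀)
    (hsol : IsSolution d μ J f h₀ u₀ u h) (hspread : Spreading ustar u h)
    {A : ℝ} (hA : 0 < A) (hAu : A < ustar) :
    ∃ c, 0 < c ∧ ∀ᶠ t in atTop, c * (t * Real.log t) ≤ h t ∧
      ∀ x, 0 ≤ x → x ≤ c * (t * Real.log t) → A ≤ u t x := by
  obtain ⟨c₁, c₂, R, hc₁, -, hR, hJR⟩ := hJγ
  obtain ⟨c, hc, hgain⟩ := hJ.exists_gain_two hc₁ hR (fun x hx => (hJR x hx).1)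
    (div_pos (hf.pos_of_lt hA hAu) hA) hd
  obtain ⟨c', H, hc', hspeed⟩ := hsol.exists_speed hd hμ hJ hf hu₀ hspread hA hAu
    ⟨by norm_num, by norm_num⟩ (G := Real.log) hc hgain
  -- For `g = k (t+θ) log (t+θ)` one has `g' ≤ 2k log (t+θ)`, while `g ≥ √(t+θ)` gives `c' log g ≥
  -- 4k log (t+θ)`.
  set k := c' / 8 with hk
  have hk0 : 0 < k := by positivity
  have hev : ∀ᶠ θ : ℝ in atTop, 1 ≤ k * √θ ∧ 1 ≤ Real.log θ ∧ H ≤ √θ ∧ 1 ≤ θ := by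
    filter_upwards [(Real.tendsto_sqrt_atTop.const_mul_atTop hk0).eventually_ge_atTop 1,
      Real.tendsto_log_atTop.eventually_ge_atTop 1,
      Real.tendsto_sqrt_atTop.eventually_ge_atTop H, eventually_ge_atTop 1]
      with θ h1 h2 h3 h4 using ⟨h1, h2, h3, h4⟩
  obtain ⟨θ, hθ⟩ := eventually_atTop.1 hev
  have hθ1 : 1 ≤ θ := (hθ θ le_rfl).2.2.2
  have hbase : ∀ t, 0 ≤ t → √(t + θ) ≤ k * ((t + θ) * Real.log (t + θ)) := fun t ht => by
    obtain ⟨h1, h2, -, h3⟩ := hθ (t + θ) (by linarith)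
    have hs := Real.sqrt_nonneg (t + θ)
    calc √(t + θ) = 1 * √(t + θ) * 1 := by ring
      _ ≤ (k * √(t + θ)) * √(t + θ) * Real.log (t + θ) := by gcongr
      _ = k * ((√(t + θ) * √(t + θ)) * Real.log (t + θ)) := by ring
      _ = _ := by rw [Real.mul_self_sqrt (by linarith)]
  refine (hspeed (fun t => k * ((t + θ) * Real.log (t + θ)))
    (fun t => k * (1 * Real.log (t + θ) + (t + θ) * (1 / (t + θ))))
    (fun t ht => ?_) (fun t ht => ?_) (fun t ht => ?_) (fun t ht => ?_)).elim fun t₀ ht₀ => ?_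
  · have h0 : t + θ ≠ 0 := by linarith
    have h1 : HasDerivAt (fun t : ℝ => t + θ) 1 t := (hasDerivAt_id t).add_const θ
    exact (h1.mul (h1.log h0)).const_mul k
  · have h1 : 0 < t + θ := by linarith
    have h2 := (hθ (t + θ) (by linarith)).2.1
    positivity
  · exact (hθ (t + θ) (by linarith)).2.2.1.trans (hbase t ht)
  · have h1 : 0 < t + θ := by linarith
    have h2 := (hθ (t + θ) (by linarith)).2.1
    have h3 := Real.log_le_log (Real.sqrt_pos.2 h1) (hbase t ht)
    rw [Real.log_sqrt h1.le] at h3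
    rw [mul_one_div_cancel h1.ne', one_mul]
    have h4 := mul_le_mul_of_nonneg_left h3 hk0.le
    have h5 := mul_le_mul_of_nonneg_left h2 hk0.le
    have hc8 : c' = 8 * k := by rw [hk]; ring
    rw [hc8]
    linarith
  -- One factor `1/2` each for the time shift, for the logarithm of the shifted time, and for the
  -- half of `[0, g]` on which `u ≥ A`.
  · refine ⟨k / 8, by positivity, ?_⟩
    filter_upwards [eventually_ge_atTop t₀, eventually_ge_atTop (2 * t₀), eventually_ge_atTop 4]
      with t h1 h2 h3
    have ht0 : 0 < t := by linarith
    have hlog : Real.log t / 2 ≤ Real.log (t - t₀ + θ) := by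
      rw [← Real.log_sqrt ht0.le]
      refine Real.log_le_log (Real.sqrt_pos.2 ht0) ?_
      have h4 : √t ≤ t / 2 := by
        rw [Real.sqrt_le_left (by linarith)]
        nlinarith
      linarith
    have hl0 : 0 ≤ Real.log t := Real.log_nonneg (by linarith)
    have hle : t / 2 * (Real.log t / 2) ≤ (t - t₀ + θ) * Real.log (t - t₀ + θ) :=
      mul_le_mul (by linarith) hlog (by positivity) (by linarith)
    have hle' := mul_le_mul_of_nonneg_left hle hk0.le
    have hpos : 0 ≤ k * (t * Real.log t) := by positivity
    obtain ⟨h4, h5⟩ := ht₀ t h1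
    refine ⟨?_, fun x hx hx' => h5 x hx ?_⟩
    · linarith
    · linarith

end

end NonlocalFB

theorem theorem4p1 (d μ h₀ γ ustar : ℝ) (J f u₀ : ℝ → ℝ) (u : ℝ → ℝ → ℝ) (h : ℝ → ℝ)
    (hd : 0 < d) (hμ : 0 < μ) (hγ : γ ∈ Set.Ioc (1 : ℝ) 2)
    (hJ : NonlocalFB.KernelCond J) (hJγ : NonlocalFB.PowerTail γ J)
    (hf : NonlocalFB.GrowthCond f ustar) (hu₀ : NonlocalFB.InitialCond h₀ u₀)
    (hsol : NonlocalFB.IsSolution d μ J f h₀ u₀ u h)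
    (hspread : NonlocalFB.Spreading ustar u h) :
    (γ < 2 →
      NonlocalFB.Comparable h (fun t => t ^ (1 / (γ - 1))) ∧
      ∀ s : ℝ → ℝ, (∀ᶠ t in Filter.atTop, 0 ≤ s t) →
        s =o[Filter.atTop] (fun t : ℝ => t ^ (1 / (γ - 1))) →
        NonlocalFB.ConvergesUpTo ustar u h s) ∧
    (γ = 2 →
      NonlocalFB.Comparable h (fun t => t * Real.log t) ∧
      ∀ s : ℝ → ℝ, (∀ᶠ t in Filter.atTop, 0 ≤ s t) →
        s =o[Filter.atTop] (fun t : ℝ => t * Real.log t) →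
        NonlocalFB.ConvergesUpTo ustar u h s) := by
  constructor
  · intro hγ2
    have hγ' : γ ∈ Ioo (1 : ℝ) 2 := ⟨hγ.1, hγ2⟩
    obtain ⟨c₁, c₂, R, -, -, hR, hJR⟩ := id hJγ
    obtain ⟨C, h', hC, hh'⟩ := hsol.exists_speed_le hd hμ hJ hf hu₀ hspread.1
      (G := fun g => g ^ (2 - γ))
      (hJ.exists_integral_tail_le_of_lt_two hγ' hR fun x hx => (hJR x hx).2)
    exact hsol.comparable_and_converges hd hJ hf hu₀
      ((eventually_gt_atTop 0).mono fun t ht => Real.rpow_pos_of_pos ht _)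
      (fun A hA hAu => hsol.lower_of_lt_two hd hμ hJ hJγ hf hu₀ hspread hγ' hA hAu)
      (NonlocalFB.eventually_le_rpow_of_speed_le hγ' hC hspread.1 hh')
  · intro hγ2
    subst hγ2
    obtain ⟨c₁, c₂, R, -, -, hR, hJR⟩ := id hJγ
    obtain ⟨C, h', hC, hh'⟩ := hsol.exists_speed_le hd hμ hJ hf hu₀ hspread.1 (G := Real.log)
      (hJ.exists_integral_tail_le_two hR fun x hx => (hJR x hx).2)
    exact hsol.comparable_and_converges hd hJ hf hu₀
      ((eventually_gt_atTop 1).mono fun t ht => mul_pos (one_pos.trans ht) (Real.log_pos ht))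
      (fun A hA hAu => hsol.lower_two hd hμ hJ hJγ hf hu₀ hspread hA hAu)
      (NonlocalFB.eventually_le_mul_log_of_speed_le hC hspread.1 hh')
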